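/- **Definitions.** A *congestion game with mixed objectives* $\Gamma$ consists of a finite set $N$ of $n$ players, a finite set $R$ of $m$ resources, for each player $i$ a non-empty strategy space $\Sigma_i\subseteq 2^R$ and a preference value $\alpha_i\in[0,1]$, and for each resource $r$ two non-decreasing functions $\ell_r,e_r:\{1,\dots,n\}\to\mathbb R$ (latency cost and bottleneck cost). In a state $S=(S_i)_{i\in N}\in\prod_i\Sigma_i$ let $n_r(S)=|\{i: r\in S_i\}|$; the cost of player $i$ is $$c_i(S)=\alpha_i\sum_{r\in S_i}\ell_r(n_r(S))+(1-\alpha_i)\max_{r\in S_i}e_r(n_r(S))$$ (the maximum over the empty set is read as $0$). A *pure Nash equilibrium* (PNE) is a state $S$ with $c_i(S)\le c_i(S_i',S_{-i})$ for all $i\in N$ and $S_i'\in\Sigma_i$. The game is a *singleton game* if all strategies have exactly one element; it is a *matroid game* if each $\Sigma_i$ is the set of bases of a matroid on $R$ (depending on $i$); the players have *pure preferences* if $\alpha_i\in\{0,1\}$ for all $i$; the costs have a *monotone dependence* if there is a non-decreasing $f:\mathbb R\to\mathbb R$ with $e_r(x)=f(\ell_r(x))$ for all $r\in R$ and $x\in\{1,\dots,n\}$.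 **Theorem.** Suppose that $\Gamma$ is (1) a singleton game, or (2) a matroid game whose players have pure preferences, or (3) a matroid game whose costs have a monotone dependence. Then $\Gamma$ has a pure Nash equilibrium. Moreover, a PNE can be computed in polynomial time: there are one algorithm (a program for a random access machine over the integers with logarithmic cost) and one polynomial $p$ such that, for every such game with rational preference values and rational costs, given $n$, $m$, and all $\alpha_i$, $\ell_r(x)$, $e_r(x)$ as pairs of binary numerators and denominators, and given access to the strategy spaces through an independence oracle (which answers whether a set $X\subseteq R$ is contained in some strategy of player $i$; a query is charged the length of the list that describes $X$), the algorithm halts with a PNE of the game after time at most $p(L)$, where $L$ is $n+m$ plus the total bit length of these numbers. -/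

import Mathlib

/-! ## Congestion games with mixed objectives -/

/-- A congestion game with mixed objectives: players `N`, resources `R`. The costs `lat r k` and
`bot r k` of a resource depend on its congestion `k ∈ {1, …, |N|}`; values at other `k` are
irrelevant. -/
structure MixedGame (N R : Type*) [Fintype N] where
  /-- the strategy space of each player -/
  strat : N → Set (Finset R)
  strat_nonempty : ∀ i, (strat i).Nonempty
  /-- the preference value of each player -/
  pref : N → ℝ
  pref_mem : ∀ i, pref i ∈ Set.Icc (0 : ℝ) 1
  /-- the latency cost function of each resource -/
  lat : R → ℕ → ℝ
  lat_mono : ∀ r, MonotoneOn (lat r) (Set.Icc 1 (Fintype.card N))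
  /-- the bottleneck cost function of each resource -/
  bot : R → ℕ → ℝ
  bot_mono : ∀ r, MonotoneOn (bot r) (Set.Icc 1 (Fintype.card N))

namespace MixedGame

variable {N R : Type*} [Fintype N] [DecidableEq N] [DecidableEq R]

/-- The number of players that use resource `r` in `S`. -/
def congestion (S : N → Finset R) (r : R) : ℕ :=
  (Finset.univ.filter fun i => r ∈ S i).card

/-- The maximum of `w` over `s` (with value `0` for the empty set). -/
noncomputable def maxOver (s : Finset R) (w : R → ℝ) : ℝ :=
  if h : s.Nonempty then s.sup' h w else 0

/-- The total cost of player `i` in state `S`. -/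
noncomputable def cost (G : MixedGame N R) (S : N → Finset R) (i : N) : ℝ :=
  G.pref i * ∑ r ∈ S i, G.lat r (congestion S r) +
    (1 - G.pref i) * maxOver (S i) fun r => G.bot r (congestion S r)

/-- `S` is a state of `G` and a pure Nash equilibrium. -/
def IsPNE (G : MixedGame N R) (S : N → Finset R) : Prop :=
  (∀ i, S i ∈ G.strat i) ∧
    ∀ i, ∀ s ∈ G.strat i, G.cost S i ≤ G.cost (Function.update S i s) i

/-- Every strategy consists of exactly one resource. -/
def IsSingletonGame (G : MixedGame N R) : Prop :=
  ∀ i, ∀ s ∈ G.strat i, s.card = 1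

/-- The strategy space of each player is the set of bases of a matroid on the resources
(the matroids of different players may differ). -/
def IsMatroidGame (G : MixedGame N R) : Prop :=
  ∀ i, ∃ M : Matroid R, M.E = Set.univ ∧ ∀ s : Finset R, s ∈ G.strat i ↔ M.IsBase (s : Set R)

/-- All preference values are `0` or `1`. -/
def HasPurePreferences (G : MixedGame N R) : Prop :=
  ∀ i, G.pref i = 0 ∨ G.pref i = 1

/-- One non-decreasing function `f` gives the bottleneck cost from the latency cost, for all
resources and all congestions. -/
def HasMonotoneDependence (G : MixedGame N R) : Prop :=
  ∃ f : ℝ → ℝ, Monotone f ∧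
    ∀ r, ∀ k ∈ Set.Icc 1 (Fintype.card N), G.bot r k = f (G.lat r k)

end MixedGame

/-! ## A random access machine with logarithmic cost and an oracle -/

namespace Ram

/-- The memory: integer tables, named by natural numbers, with cells addressed by two integers. -/
abbrev Mem := ℕ → ℤ → ℤ → ℤ

/-- An oracle is asked about an integer and a finite list of integers and says yes or no. -/
abbrev Oracle := ℤ → List ℤ → Prop

/-- Bit length of an integer, with one bit for the sign. -/
def bits (z : ℤ) : ℕ := z.natAbs.size + 1

/-- Arithmetic expressions; `read t a b` is the content of cell `(a, b)` of table `t`. -/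
inductive Exp where
  | const (z : ℤ)
  | read (t : ℕ) (a b : Exp)
  | add (x y : Exp)
  | sub (x y : Exp)
  | mul (x y : Exp)

/-- Value of an expression. -/
def Exp.val (M : Mem) : Exp → ℤ
  | const z => z
  | read t a b => M t (a.val M) (b.val M)
  | add x y => x.val M + y.val M
  | sub x y => x.val M - y.val M
  | mul x y => x.val M * y.val M

/-- Logarithmic cost of an evaluation: the sum of the bit lengths of all intermediate values
(addresses included). -/
def Exp.time (M : Mem) : Exp → ℕ
  | const z => bits z
  | read t a b => a.time M + b.time M + bits ((read t a b).val M)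
  | add x y => x.time M + y.time M + bits ((add x y).val M)
  | sub x y => x.time M + y.time M + bits ((sub x y).val M)
  | mul x y => x.time M + y.time M + bits ((mul x y).val M)

/-- Programs. Tests are of the form `0 < e`. The command `query d e t a len` asks the oracle about
the value of `e` and the first `len` entries of row `a` of table `t`, and stores the answer
(`1` or `0`) in cell `(0, 0)` of table `d`. -/
inductive Prog where
  | skip
  | write (t : ℕ) (a b e : Exp)
  | seq (p q : Prog)
  | ite (e : Exp) (p q : Prog)
  | while (e : Exp) (p : Prog)
  | query (d : ℕ) (e : Exp) (t : ℕ) (a len : Exp)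

/-- The memory after storing `z` in cell `(a, b)` of table `t`. -/
def Mem.set (M : Mem) (t : ℕ) (a b z : ℤ) : Mem :=
  fun t' a' b' => if t' = t ∧ a' = a ∧ b' = b then z else M t' a' b'

/-- The entries `0, …, len - 1` of row `a` of table `t`. -/
def Mem.rowList (M : Mem) (t : ℕ) (a len : ℤ) : List ℤ :=
  (List.range len.toNat).map fun k => M t a k

open Classical in
/-- `Exec O p M c M'`: with oracle `O`, the program `p` started in memory `M` halts in memory `M'`
after time `c`. -/
inductive Exec (O : Oracle) : Prog → Mem → ℕ → Mem → Prop
  | skip (M : Mem) : Exec O .skip M 1 M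
  | write (M : Mem) (t : ℕ) (a b e : Exp) :
      Exec O (.write t a b e) M (1 + a.time M + b.time M + e.time M)
        (M.set t (a.val M) (b.val M) (e.val M))
  | seq {p q : Prog} {M M' M'' : Mem} {c c' : ℕ} :
      Exec O p M c M' → Exec O q M' c' M'' → Exec O (.seq p q) M (1 + c + c') M''
  | ite_pos {e : Exp} {p q : Prog} {M M' : Mem} {c : ℕ} :
      0 < e.val M → Exec O p M c M' → Exec O (.ite e p q) M (1 + e.time M + c) M'
  | ite_neg {e : Exp} {p q : Prog} {M M' : Mem} {c : ℕ} :
      ¬ 0 < e.val M → Exec O q M c M' → Exec O (.ite e p q) M (1 + e.time M + c) M'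
  | while_done {e : Exp} {p : Prog} {M : Mem} :
      ¬ 0 < e.val M → Exec O (.while e p) M (1 + e.time M) M
  | while_step {e : Exp} {p : Prog} {M M' M'' : Mem} {c c' : ℕ} :
      0 < e.val M → Exec O p M c M' → Exec O (.while e p) M' c' M'' →
        Exec O (.while e p) M (1 + e.time M + c + c') M''
  | query (M : Mem) (d : ℕ) (e : Exp) (t : ℕ) (a len : Exp) :
      Exec O (.query d e t a len) M
        (1 + e.time M + a.time M + len.time M +
          ((M.rowList t (a.val M) (len.val M)).map bits).sum)
        (M.set d 0 0 (if O (e.val M) (M.rowList t (a.val M) (len.val M)) then 1 else 0))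

/-- The table with entries `f i j`, filled up with zeros. -/
def table {n m : ℕ} (f : Fin n → Fin m → ℤ) (a b : ℤ) : ℤ :=
  if h : (0 ≤ a ∧ a < n) ∧ (0 ≤ b ∧ b < m) then
    f ⟨a.toNat, by omega⟩ ⟨b.toNat, by omega⟩
  else 0

end Ram

/-! ## Rational instances, their size, and the input and output of an algorithm -/

/-- Rational numbers that specify preference values and costs for `n` players and `m` resources;
`lat r k` and `bot r k` are the costs of resource `r` at congestion `k + 1`. -/
structure RatData (n m : ℕ) where
  pref : Fin n → ℚ
  lat : Fin m → Fin n → ℚ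
  bot : Fin m → Fin n → ℚ

namespace RatData

variable {n m : ℕ}

/-- The numbers of the game `G` are those listed in `q`. -/
def Specifies (q : RatData n m) (G : MixedGame (Fin n) (Fin m)) : Prop :=
  (∀ i, G.pref i = q.pref i) ∧
    ∀ (r : Fin m) (k : Fin n), G.lat r (k + 1) = q.lat r k ∧ G.bot r (k + 1) = q.bot r k

/-- Bit length of a rational number, given by numerator and denominator. -/
def ratBits (x : ℚ) : ℕ := Ram.bits x.num + Ram.bits x.den

/-- The input size: number of players, number of resources, and total bit length of the data. -/
def size (q : RatData n m) : ℕ :=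
  n + m + ∑ i, ratBits (q.pref i) + ∑ r, ∑ k, (ratBits (q.lat r k) + ratBits (q.bot r k))

/-- The initial memory. Table `0` holds the numbers `n` and `m`; tables `1` and `2` hold the
numerators and denominators of the preference values (in column `0`), tables `3` and `4` those of
the latency costs, tables `5` and `6` those of the bottleneck costs; all else is zero. -/
def input (q : RatData n m) : Ram.Mem
  | 0 => Ram.table (n := 1) (m := 2) fun _ j => if j = 0 then n else m
  | 1 => Ram.table (m := 1) fun i _ => (q.pref i).num
  | 2 => Ram.table (m := 1) fun i _ => (q.pref i).den
  | 3 => Ram.table fun r k => (q.lat r k).num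
  | 4 => Ram.table fun r k => (q.lat r k).den
  | 5 => Ram.table fun r k => (q.bot r k).num
  | 6 => Ram.table fun r k => (q.bot r k).den
  | _ => fun _ _ => 0

end RatData

namespace MixedGame

variable {n m : ℕ}

/-- The independence oracle of the strategy spaces: asked about `p` and a list, it says whether
`p` is a player and the set of resources marked by a nonzero entry is contained in one of the
strategies of that player. -/
def indepOracle (G : MixedGame (Fin n) (Fin m)) : Ram.Oracle := fun p l =>
  ∃ i : Fin n, (i : ℤ) = p ∧ ∃ s ∈ G.strat i, ∀ r : Fin m, l.getD r 0 ≠ 0 → r ∈ s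

/-- Table `7` of the memory contains the incidence matrix of the state `S`. -/
def Outputs (M : Ram.Mem) (S : Fin n → Finset (Fin m)) : Prop :=
  ∀ (i : Fin n) (r : Fin m), M 7 i r = if r ∈ S i then 1 else 0

end MixedGame

/-! Give resource r at congestion k the price `key i r k` for player i, the mixture of its latency
and bottleneck cost with weights αᵢ and 1 - αᵢ. In each of the three classes, replacing an element
of an independent set by one of no larger price does not raise the true cost of the player
(`IsTractable.exchange_le`). The sets contained in strategies satisfy the augmentation axiom, in
singleton games too. Hence any strategy can be transformed by such exchanges into one that admits no
improving single exchange (`IsIndepFamily.le_of_exchangeStable`), and the latter is a best response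
(`IsTractable.isPNE`). It remains to find a state that is stable under single exchanges.

Such a state is built from empty sets by adding one resource at a time. The added use is a token on
some resource, and k counts all uses except the token. A player on the resource of the token who
gains by leaving it takes the token to the best alternative. This does not change k, and all sets
remain stable with respect to k (`IsStableAt.move`, by `IsIndepFamily.exchangeStable_move`). For
fixed k every player ranks the resources by `key i r (k r + 1)`; each move lowers a rank, so there
are at most nm² moves per token. When nobody wants to leave, the token is absorbed into k
(`IsStableAt.settle`). After at most nm insertions all sets are bases.

The program carries out this construction. It compares prices by cross-multiplication inside tests
only and stores nothing but signs, indices and counters, so cells never outgrow the bound for the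
input. The predicate `Runs` carries correctness, cell length and time together; `runs_equilibrium`
applies it to the whole program. -/

set_option linter.unusedSectionVars false

/-! ## Families of independent sets -/

/-- A hereditary family of finite sets with the augmentation property. -/
structure IsIndepFamily {R : Type*} [DecidableEq R] (I : Finset R → Prop) : Prop where
  mono : ∀ ⦃X Y : Finset R⦄, X ⊆ Y → I Y → I X
  aug : ∀ ⦃X Y : Finset R⦄, I X → I Y → X.card < Y.card → ∃ e ∈ Y, e ∉ X ∧ I (insert e X)

/-- No exchange of one element of `S` lowers the cost, where `u` gives the costs of the elements
of `S` and `v` the costs of those that may enter. -/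
def ExchangeStable {R : Type*} [DecidableEq R] (I : Finset R → Prop) (S : Finset R)
    (u v : R → ℝ) : Prop :=
  ∀ a ∈ S, ∀ b ∉ S, I (insert b (S.erase a)) → u a ≤ v b

namespace IsIndepFamily

variable {R : Type*} [DecidableEq R] {I : Finset R → Prop} {S : Finset R} {u v : R → ℝ}

/-- Two successive exchanges either contain the direct exchange of `a` for `c`, or can be crossed
into two single exchanges of `S`. This is how stability of `S` gives information on `S - t + b`. -/
theorem exchange_of_double (hI : IsIndepFamily I) (hS : I S) {a t b c : R} (ha : a ∈ S)
    (ht : t ∈ S) (hat : a ≠ t) (hb : b ∉ S) (hc : c ∉ S) (hbc : b ≠ c)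
    (h : I (insert c ((insert b (S.erase t)).erase a))) :
    I (insert c (S.erase a)) ∨ (I (insert b (S.erase a)) ∧ I (insert c (S.erase t))) := by
  have hab : a ≠ b := fun h => hb (h ▸ ha)
  have hac : a ≠ c := fun h => hc (h ▸ ha)
  have htb : t ≠ b := fun h => hb (h ▸ ht)
  have htc : t ≠ c := fun h => hc (h ▸ ht)
  by_cases h1 : I (insert c (S.erase a))
  · exact Or.inl h1
  have hcard : 2 ≤ S.card := by
    have := Finset.one_lt_card.2 ⟨a, ha, t, ht, hat⟩
    omega
  have e1 : (S.erase a).card = S.card - 1 := Finset.card_erase_of_mem ha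
  have e2 : ((S.erase t).erase a).card = S.card - 2 := by
    rw [Finset.card_erase_of_mem (by simp [ha, hat]), Finset.card_erase_of_mem ht]; omega
  refine Or.inr ⟨?_, ?_⟩
  · have e3 : (insert c ((insert b (S.erase t)).erase a)).card = S.card := by
      rw [Finset.card_insert_of_notMem (by grind),
        Finset.card_erase_of_mem (by grind), Finset.card_insert_of_notMem (by grind),
        Finset.card_erase_of_mem ht]
      omega
    -- Augment `S - a` from the doubly exchanged set: only `b` and `c` are new, and `c` is excluded.
    obtain ⟨e, he, heS, hIe⟩ := hI.aug (hI.mono (Finset.erase_subset a S) hS) h (by omega)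
    have : e = b ∨ e = c := by grind
    rcases this with rfl | rfl
    · exact hIe
    · exact absurd hIe h1
  · have e3 : (insert c ((S.erase t).erase a)).card = S.card - 1 := by
      rw [Finset.card_insert_of_notMem (by grind), e2]; omega
    have i3 : I (insert c ((S.erase t).erase a)) := hI.mono (by intro x; grind) h
    -- Augment `S - t - a + c` from `S`: adding `t` would give the excluded exchange, so `a` is
    -- added.
    obtain ⟨e, he, heS, hIe⟩ := hI.aug i3 hS (by omega)
    have : e = a ∨ e = t := by grind
    rcases this with rfl | rfl
    · exact hI.mono (by intro x; grind) hIe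
    · exact absurd (hI.mono (by intro x; grind) hIe) h1

/-- An exchange of the new element is harmless because `b` was the best choice. An exchange of an
old element `a` for `c` is traced back to `S`: in the crossed case `u a ≤ v b ≤ v c`, by stability
and minimality. -/
theorem exchangeStable_move (hI : IsIndepFamily I) (hS : I S) (huv : ∀ r, u r ≤ v r)
    (hst : ExchangeStable I S u v) {t b : R} (ht : t ∈ S) (hb : b ∉ S) (hlt : v b < v t)
    (hmin : ∀ c ∉ S, I (insert c (S.erase t)) → v b ≤ v c) :
    ExchangeStable I (insert b (S.erase t)) u v := by
  intro a ha c hc h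
  by_cases hab : a = b
  · subst hab
    by_cases hct : c = t
    · subst hct
      exact (huv a).trans hlt.le
    · exact (huv a).trans (hmin c (by grind) (hI.mono (by intro x; grind) h))
  · have haS : a ∈ S := by grind
    have hat : a ≠ t := by grind
    by_cases hct : c = t
    · subst hct
      exact (hst a haS b hb (hI.mono (by intro x; grind) h)).trans hlt.le
    · have hcS : c ∉ S := by grind
      rcases hI.exchange_of_double hS haS ht hat hb hcS (by grind) h with h1 | ⟨h1, h2⟩
      · exact hst a haS c hcS h1
      · exact (hst a haS b hb h1).trans (hmin c hcS h2)

theorem exchangeStable_insert (hI : IsIndepFamily I) (huv : ∀ r, u r ≤ v r)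
    (hst : ExchangeStable I S u v) {b : R} (hb : b ∉ S)
    (hmin : ∀ c ∉ S, I (insert c S) → v b ≤ v c) :
    ExchangeStable I (insert b S) u v := by
  intro a ha c hc h
  by_cases hab : a = b
  · subst hab
    exact (huv a).trans (hmin c (by grind) (hI.mono (by intro x; grind) h))
  · exact hst a (by grind) c (by grind) (hI.mono (by intro x; grind) h)

theorem exists_exchange_le (hI : IsIndepFamily I) {B : Finset R} (hS : I S) (hB : I B)
    (hcard : S.card = B.card) (hst : ExchangeStable I S v v) (hne : S ≠ B) :
    ∃ b ∈ B, b ∉ S ∧ ∃ a ∈ S, a ∉ B ∧ v a ≤ v b ∧ I (insert a (B.erase b)) := by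
  have hBS : (B \ S).Nonempty := by
    rw [Finset.sdiff_nonempty]
    exact fun h => hne (Finset.eq_of_subset_of_card_le h hcard.le).symm
  -- With the heaviest `b`, stability need only compare `a` with some element of `B \ S`: the `c`
  -- found below satisfies `v a ≤ v c ≤ v b`.
  obtain ⟨b, hb, hmax⟩ := Finset.exists_max_image _ v hBS
  rw [Finset.mem_sdiff] at hb
  have hpos : 0 < B.card := Finset.card_pos.2 ⟨b, hb.1⟩
  obtain ⟨a, ha, haB, hIa⟩ := hI.aug (hI.mono (Finset.erase_subset b B) hB) hS
    (by rw [Finset.card_erase_of_mem hb.1]; omega)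
  have haB' : a ∉ B := by grind
  obtain ⟨c, hc, hcS, hIc⟩ := hI.aug (hI.mono (Finset.erase_subset a S) hS) hB
    (by rw [Finset.card_erase_of_mem ha]; omega)
  have hcS' : c ∉ S := by grind
  exact ⟨b, hb.1, hb.2, a, ha, haB', (hst a ha c hcS' hIc).trans (hmax c (by simp [hc, hcS'])), hIa⟩

/-- An exchange-stable set is optimal for every set function that does not increase when an
element is replaced by one that is not heavier. -/
theorem le_of_exchangeStable (hI : IsIndepFamily I) (C : Finset R → ℝ) (hS : I S)
    (hst : ExchangeStable I S v v)
    (hC : ∀ X, I X → ∀ b ∈ X, ∀ a ∉ X, v a ≤ v b → I (insert a (X.erase b)) →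
      C (insert a (X.erase b)) ≤ C X) :
    ∀ B, I B → S.card = B.card → C S ≤ C B := by
  intro B
  induction hn : (B \ S).card using Nat.strong_induction_on generalizing B with
  | _ n ih =>
    intro hB hcard
    by_cases hne : S = B
    · rw [hne]
    obtain ⟨b, hb, hbS, a, ha, haB, hle, hIa⟩ := hI.exists_exchange_le hS hB hcard hst hne
    refine le_trans (ih _ ?_ _ rfl hIa ?_) (hC B hB b hb a haB hle hIa)
    · rw [← hn]
      refine Finset.card_lt_card ⟨by intro x; grind, fun h => ?_⟩
      have := h (Finset.mem_sdiff.2 ⟨hb, hbS⟩)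
      grind
    · rw [Finset.card_insert_of_notMem (by grind), Finset.card_erase_of_mem hb]
      have : 0 < B.card := Finset.card_pos.2 ⟨b, hb⟩
      omega

theorem card_le_of_maximal (hI : IsIndepFamily I) (hS : I S)
    (hmax : ∀ b ∉ S, ¬ I (insert b S)) (X : Finset R) (hX : I X) : X.card ≤ S.card := by
  by_contra! h
  obtain ⟨e, -, he, hIe⟩ := hI.aug hS hX h
  exact hmax e he hIe

end IsIndepFamily

namespace MixedGame

variable {N R : Type*} [Fintype N] [DecidableEq N] [DecidableEq R]

/-! ## Optimality of exchange-stable strategies -/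

/-- `X` is contained in a strategy of player `i`. -/
def Indep (G : MixedGame N R) (i : N) (X : Finset R) : Prop := ∃ s ∈ G.strat i, X ⊆ s

/-- The three classes of games in which equilibria exist. -/
def IsTractable (G : MixedGame N R) : Prop :=
  G.IsSingletonGame ∨ (G.IsMatroidGame ∧ G.HasPurePreferences) ∨
    (G.IsMatroidGame ∧ G.HasMonotoneDependence)

theorem indep_mono (G : MixedGame N R) (i : N) ⦃X Y : Finset R⦄ (h : X ⊆ Y) :
    G.Indep i Y → G.Indep i X := fun ⟨s, hs, hY⟩ => ⟨s, hs, h.trans hY⟩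

theorem IsSingletonGame.isIndepFamily {G : MixedGame N R} (h : G.IsSingletonGame) (i : N) :
    IsIndepFamily (G.Indep i) where
  mono := G.indep_mono i
  aug := by
    rintro X Y - ⟨s, hs, hY⟩ hlt
    have h1 := h i s hs
    have h2 := Finset.card_le_card hY
    have hX : X = ∅ := Finset.card_eq_zero.1 (by omega)
    obtain ⟨y, rfl⟩ := Finset.card_eq_one.1 (show Y.card = 1 by omega)
    exact ⟨y, by simp, by simp [hX], s, hs, by simpa [hX] using hY⟩

theorem IsMatroidGame.isIndepFamily [Finite R] {G : MixedGame N R} (h : G.IsMatroidGame) (i : N) :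
    IsIndepFamily (G.Indep i) := by
  obtain ⟨M, -, hM⟩ := h i
  have key : ∀ X : Finset R, G.Indep i X ↔ M.Indep (X : Set R) := by
    intro X
    rw [Matroid.indep_iff]
    constructor
    · rintro ⟨s, hs, hX⟩
      exact ⟨s, (hM s).1 hs, by exact_mod_cast hX⟩
    · rintro ⟨B, hB, hX⟩
      refine ⟨B.toFinite.toFinset, (hM _).2 (by simpa using hB), ?_⟩
      intro x hx
      simpa using hX hx
  refine ⟨G.indep_mono i, fun X Y hX hY hlt => ?_⟩
  obtain ⟨x, hx, hxX, hI⟩ := ((key X).1 hX).augment_finset ((key Y).1 hY) hlt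
  exact ⟨x, hx, hxX, (key _).2 (by simpa using hI)⟩

theorem IsTractable.isIndepFamily [Finite R] {G : MixedGame N R} (h : G.IsTractable) (i : N) :
    IsIndepFamily (G.Indep i) := by
  rcases h with h | ⟨h, -⟩ | ⟨h, -⟩
  · exact h.isIndepFamily i
  · exact h.isIndepFamily i
  · exact h.isIndepFamily i

theorem IsTractable.card_eq {G : MixedGame N R} (h : G.IsTractable) {i : N} {s t : Finset R}
    (hs : s ∈ G.strat i) (ht : t ∈ G.strat i) : s.card = t.card := by
  have aux : G.IsMatroidGame → s.card = t.card := by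
    intro h
    obtain ⟨M, -, hM⟩ := h i
    simpa using ((hM s).1 hs).ncard_eq_ncard_of_isBase ((hM t).1 ht)
  rcases h with h | ⟨h, -⟩ | ⟨h, -⟩
  · rw [h i s hs, h i t ht]
  · exact aux h
  · exact aux h

theorem indep_empty (G : MixedGame N R) (i : N) : G.Indep i ∅ :=
  let ⟨s, hs⟩ := G.strat_nonempty i
  ⟨s, hs, by simp⟩

/-! ### Prices of single resources and best responses -/

/-- The congestion moved into the range `{1, …, |N|}`. -/
def clampCong (N : Type*) [Fintype N] (k : ℕ) : ℕ := max 1 (min k (Fintype.card N))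

theorem clampCong_of_mem {k : ℕ} (hk : k ∈ Set.Icc 1 (Fintype.card N)) : clampCong N k = k := by
  have := hk.1
  have := hk.2
  simp only [clampCong]
  omega

/-- The cost of the single resource `r` at congestion `k` for player `i`. -/
noncomputable def key (G : MixedGame N R) (i : N) (r : R) (k : ℕ) : ℝ :=
  G.pref i * G.lat r (clampCong N k) + (1 - G.pref i) * G.bot r (clampCong N k)

/-- Clamping makes this true on all of ℕ. It is needed since `k` omits the token and may be `0` on a
resource in use, while the costs are monotone only on `{1, …, n}`. -/
theorem key_mono (G : MixedGame N R) (i : N) (r : R) : Monotone (G.key i r) := by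
  intro k l hkl
  have hN : 1 ≤ Fintype.card N := Fintype.card_pos_iff.2 ⟨i⟩
  have hmem : ∀ k, clampCong N k ∈ Set.Icc 1 (Fintype.card N) := by
    intro k
    simp only [clampCong, Set.mem_Icc]
    omega
  have hle : clampCong N k ≤ clampCong N l := by
    simp only [clampCong]
    omega
  have h := G.pref_mem i
  exact add_le_add (mul_le_mul_of_nonneg_left (G.lat_mono r (hmem k) (hmem l) hle) h.1)
    (mul_le_mul_of_nonneg_left (G.bot_mono r (hmem k) (hmem l) hle) (by linarith [h.2]))

theorem maxOver_exchange_le {X : Finset R} {w : R → ℝ} {a b : R} (hb : b ∈ X) (h : w a ≤ w b) :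
    maxOver (insert a (X.erase b)) w ≤ maxOver X w := by
  have hX : X.Nonempty := ⟨b, hb⟩
  rw [maxOver, maxOver, dif_pos (Finset.insert_nonempty _ _), dif_pos hX]
  refine Finset.sup'_le _ _ fun x hx => ?_
  rcases Finset.mem_insert.1 hx with rfl | hx
  · exact h.trans (Finset.le_sup' w hb)
  · exact Finset.le_sup' w (Finset.mem_of_mem_erase hx)

theorem sum_exchange_le {X : Finset R} {w : R → ℝ} {a b : R} (hb : b ∈ X) (ha : a ∉ X)
    (h : w a ≤ w b) : ∑ r ∈ insert a (X.erase b), w r ≤ ∑ r ∈ X, w r := by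
  rw [Finset.sum_insert (fun h => ha (Finset.mem_of_mem_erase h)), ← Finset.add_sum_erase X w hb]
  linarith

theorem congestion_update (S : N → Finset R) (j : N) (X : Finset R) (r : R) :
    congestion (Function.update S j X) r + (if r ∈ S j then 1 else 0) =
      congestion S r + (if r ∈ X then 1 else 0) := by
  simp only [congestion, Finset.card_filter]
  rw [← Finset.add_sum_erase _ _ (Finset.mem_univ j),
    ← Finset.add_sum_erase (s := Finset.univ) (a := j) (fun i => if r ∈ S i then 1 else 0)
      (Finset.mem_univ j)]
  have : ∑ x ∈ Finset.univ.erase j, (if r ∈ Function.update S j X x then 1 else 0) =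
      ∑ x ∈ Finset.univ.erase j, if r ∈ S x then 1 else 0 := by
    refine Finset.sum_congr rfl fun x hx => ?_
    rw [Function.update_of_ne (Finset.ne_of_mem_erase hx)]
  rw [this, Function.update_self]
  ring

theorem congestion_le_card (S : N → Finset R) (r : R) : congestion S r ≤ Fintype.card N :=
  (Finset.card_le_univ _)

/-- If player `i` also used `r`, the congestion would be larger by one and still at most `|N|`. -/
theorem congestion_lt_card {S : N → Finset R} {r : R} {i : N} (h : r ∉ S i) :
    congestion S r < Fintype.card N := by
  have h1 := congestion_update S i {r} r
  have h2 := congestion_le_card (Function.update S i {r}) r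
  simp [h] at h1
  omega

/-- The only place where the three classes matter for costs. For singletons the price is the cost;
for pure preferences it is the one cost component that counts; under monotone dependence a price
comparison gives the same comparison in every component with positive weight. -/
theorem IsTractable.exchange_le {G : MixedGame N R} (h : G.IsTractable) (i : N) (k : R → ℕ)
    (hk : ∀ r, k r < Fintype.card N) {X : Finset R} (hX : G.Indep i X) {a b : R} (hb : b ∈ X)
    (ha : a ∉ X) (hle : G.key i a (k a + 1) ≤ G.key i b (k b + 1)) :
    G.pref i * ∑ r ∈ insert a (X.erase b), G.lat r (k r + 1) +
        (1 - G.pref i) * maxOver (insert a (X.erase b)) (fun r => G.bot r (k r + 1)) ≤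
      G.pref i * ∑ r ∈ X, G.lat r (k r + 1) +
        (1 - G.pref i) * maxOver X (fun r => G.bot r (k r + 1)) := by
  have hmem : ∀ r, k r + 1 ∈ Set.Icc 1 (Fintype.card N) := fun r => ⟨by omega, hk r⟩
  rw [key, key, clampCong_of_mem (hmem a), clampCong_of_mem (hmem b)] at hle
  obtain ⟨hp0, hp1⟩ := G.pref_mem i
  have both : (G.pref i = 0 ∨ G.lat a (k a + 1) ≤ G.lat b (k b + 1)) →
      (G.pref i = 1 ∨ G.bot a (k a + 1) ≤ G.bot b (k b + 1)) →
      G.pref i * ∑ r ∈ insert a (X.erase b), G.lat r (k r + 1) +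
        (1 - G.pref i) * maxOver (insert a (X.erase b)) (fun r => G.bot r (k r + 1)) ≤
      G.pref i * ∑ r ∈ X, G.lat r (k r + 1) +
        (1 - G.pref i) * maxOver X (fun r => G.bot r (k r + 1)) := by
    intro h1 h2
    refine add_le_add ?_ ?_
    · rcases h1 with h1 | h1
      · simp [h1]
      · exact mul_le_mul_of_nonneg_left (sum_exchange_le (w := fun r => G.lat r (k r + 1)) hb ha h1)
          hp0
    · rcases h2 with h2 | h2
      · simp [h2]
      · exact mul_le_mul_of_nonneg_left (maxOver_exchange_le hb h2) (by linarith)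
  rcases h with h | ⟨-, h⟩ | ⟨-, f, hf, hfe⟩
  · obtain ⟨s, hs, hXs⟩ := hX
    have h1 := h i s hs
    have h2 := Finset.card_le_card hXs
    have h3 : 0 < X.card := Finset.card_pos.2 ⟨b, hb⟩
    obtain ⟨y, rfl⟩ := Finset.card_eq_one.1 (show X.card = 1 by omega)
    obtain rfl : b = y := by simpa using hb
    simpa [maxOver] using hle
  · rcases h i with h | h
    · exact both (Or.inl h) (Or.inr (by simpa [h] using hle))
    · exact both (Or.inr (by simpa [h] using hle)) (Or.inl h)
  · rcases eq_or_lt_of_le hp0 with h0 | h0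
    · exact both (Or.inl h0.symm) (Or.inr (by simpa [← h0] using hle))
    · have hlat : G.lat a (k a + 1) ≤ G.lat b (k b + 1) := by
        -- A strictly larger latency of `a` would entail a bottleneck cost at least as large, hence
        -- a strictly larger price because `pref i > 0`.
        by_contra! hlt
        have h1 : G.bot b (k b + 1) ≤ G.bot a (k a + 1) := by
          rw [hfe b _ (hmem b), hfe a _ (hmem a)]
          exact hf hlt.le
        have h2 := mul_le_mul_of_nonneg_left h1 (show 0 ≤ 1 - G.pref i by linarith)
        have h3 := mul_lt_mul_of_pos_left hlt h0
        linarith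
      refine both (Or.inr hlat) (Or.inr ?_)
      rw [hfe b _ (hmem b), hfe a _ (hmem a)]
      exact hf hlat

/-- All strategies are independent and exchange-stable, where the resources in use cost
`key i r (k r)` and the others `key i r (k r + 1)`. -/
def IsStableAt (G : MixedGame N R) (S : N → Finset R) (k : R → ℕ) : Prop :=
  ∀ i, G.Indep i (S i) ∧
    ExchangeStable (G.Indep i) (S i) (fun r => G.key i r (k r)) (fun r => G.key i r (k r + 1))

theorem IsTractable.isPNE {G : MixedGame N R} [Finite R] (h : G.IsTractable) {S : N → Finset R}
    (hst : G.IsStableAt S (congestion S))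
    (hmax : ∀ i X, G.Indep i X → X.card ≤ (S i).card) : G.IsPNE S := by
  have hS : ∀ i, S i ∈ G.strat i := by
    intro i
    obtain ⟨s, hs, hSs⟩ := (hst i).1
    rwa [Finset.eq_of_subset_of_card_le hSs (hmax i s ⟨s, hs, subset_rfl⟩)]
  refine ⟨hS, fun i s hs => ?_⟩
  -- Without player `i`, every resource that it chooses has congestion `k r + 1`, so all its
  -- strategies are compared under one weight function.
  set k : R → ℕ := congestion (Function.update S i ∅) with hk
  have hkn : ∀ r, k r < Fintype.card N := fun r =>
    congestion_lt_card (i := i) (by simp)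
  have hcong : ∀ X : Finset R, ∀ r, congestion (Function.update S i X) r =
      k r + (if r ∈ X then 1 else 0) := by
    intro X r
    have := congestion_update (Function.update S i ∅) i X r
    simpa using this
  have hcost : ∀ X : Finset R, G.cost (Function.update S i X) i =
      G.pref i * ∑ r ∈ X, G.lat r (k r + 1) +
        (1 - G.pref i) * maxOver X (fun r => G.bot r (k r + 1)) := by
    intro X
    rw [cost, Function.update_self]
    have h1 : ∀ r ∈ X, congestion (Function.update S i X) r = k r + 1 := by
      intro r hr
      rw [hcong, if_pos hr]
    congr 2
    · exact Finset.sum_congr rfl fun r hr => by rw [h1 r hr]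
    · unfold maxOver
      split_ifs with hne
      · exact Finset.sup'_congr hne rfl fun r hr => by rw [h1 r hr]
      · rfl
  have hSi : Function.update S i (S i) = S := Function.update_eq_self i S
  -- A resource in use has congestion `k r + 1`, any other has `k r` and would get one more user:
  -- the two price functions in `IsStableAt` merge into one.
  have hstab : ExchangeStable (G.Indep i) (S i) (fun r => G.key i r (k r + 1))
      (fun r => G.key i r (k r + 1)) := by
    intro a ha b hb hI
    have h1 := hcong (S i) a
    have h2 := hcong (S i) b
    rw [hSi] at h1 h2
    rw [if_pos ha] at h1
    rw [if_neg hb] at h2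
    have := (hst i).2 a ha b hb hI
    simpa [h1, h2] using this
  have key := (h.isIndepFamily i).le_of_exchangeStable (S := S i)
    (fun X => G.cost (Function.update S i X) i) (hst i).1 hstab
    (fun X hX b hb a ha hle _ => by
      simp only [hcost]
      exact h.exchange_le i k hkn hX hb ha hle) s ⟨s, hs, subset_rfl⟩ (h.card_eq (hS i) hs)
  simpa only [hSi] using key

/-! ## Insertion of a resource and the moves that follow -/

/-- The congestion `k` with one more user on `t`. -/
def bump (k : R → ℕ) (t : R) (r : R) : ℕ := k r + (if r = t then 1 else 0)

/-- The sum of the ranks of all resources in use, in the players' orders of the resources. -/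
noncomputable def potential [Fintype R] (G : MixedGame N R) (k : R → ℕ) (S : N → Finset R) : ℕ :=
  ∑ i, ∑ r ∈ S i,
    (Finset.univ.filter fun r' => G.key i r' (k r' + 1) < G.key i r (k r + 1)).card

theorem potential_le [Fintype R] (G : MixedGame N R) (k : R → ℕ) (S : N → Finset R) :
    G.potential k S ≤ Fintype.card N * (Fintype.card R * Fintype.card R) := by
  have h : ∀ i ∈ (Finset.univ : Finset N), ∑ r ∈ S i,
      (Finset.univ.filter fun r' => G.key i r' (k r' + 1) < G.key i r (k r + 1)).card ≤
        Fintype.card R * Fintype.card R := by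
    intro i _
    refine (Finset.sum_le_card_nsmul _ _ (Fintype.card R) fun r _ => Finset.card_le_univ _).trans ?_
    rw [smul_eq_mul]
    exact Nat.mul_le_mul_right _ (Finset.card_le_univ _)
  simpa [potential] using Finset.sum_le_card_nsmul _ _ _ h

/-- The new use becomes the token, so `k` stays fixed and the other players are not affected. -/
theorem IsStableAt.add_resource {G : MixedGame N R} (hG : ∀ i, IsIndepFamily (G.Indep i))
    {S : N → Finset R} {k : R → ℕ} (hst : G.IsStableAt S k) {i : N} {b : R} (hb : b ∉ S i)
    (hI : G.Indep i (insert b (S i)))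
    (hmin : ∀ c ∉ S i, G.Indep i (insert c (S i)) → G.key i b (k b + 1) ≤ G.key i c (k c + 1)) :
    G.IsStableAt (Function.update S i (insert b (S i))) k := by
  intro j
  by_cases hj : j = i
  · subst hj
    rw [Function.update_self]
    exact ⟨hI, (hG j).exchangeStable_insert (fun r => G.key_mono j r (Nat.le_succ _)) (hst j).2 hb
      hmin⟩
  · rw [Function.update_of_ne hj]
    exact hst j

theorem congestion_insert {S : N → Finset R} {k : R → ℕ} (hk : congestion S = k) {i : N} {b : R}
    (hb : b ∉ S i) : congestion (Function.update S i (insert b (S i))) = bump k b := by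
  funext r
  have := congestion_update S i (insert b (S i)) r
  rw [hk] at this
  by_cases hr : r = b
  · subst hr
    simpa [bump, hb] using this
  · simpa [bump, hr] using this

theorem IsStableAt.move {G : MixedGame N R} (hG : ∀ i, IsIndepFamily (G.Indep i))
    {S : N → Finset R} {k : R → ℕ} (hst : G.IsStableAt S k) {i : N} {t b : R} (ht : t ∈ S i)
    (hb : b ∉ S i) (hI : G.Indep i (insert b ((S i).erase t)))
    (hlt : G.key i b (k b + 1) < G.key i t (k t + 1))
    (hmin : ∀ c ∉ S i, G.Indep i (insert c ((S i).erase t)) →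
      G.key i b (k b + 1) ≤ G.key i c (k c + 1)) :
    G.IsStableAt (Function.update S i (insert b ((S i).erase t))) k := by
  intro j
  by_cases hj : j = i
  · subst hj
    rw [Function.update_self]
    exact ⟨hI, (hG j).exchangeStable_move (hst j).1 (fun r => G.key_mono j r (Nat.le_succ _))
      (hst j).2 ht hb hlt hmin⟩
  · rw [Function.update_of_ne hj]
    exact hst j

theorem congestion_move {S : N → Finset R} {k : R → ℕ} {t b : R} (hk : congestion S = bump k t)
    {i : N} (ht : t ∈ S i) (hb : b ∉ S i) :
    congestion (Function.update S i (insert b ((S i).erase t))) = bump k b := by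
  funext r
  have := congestion_update S i (insert b ((S i).erase t)) r
  have htb : t ≠ b := fun h => hb (h ▸ ht)
  rw [hk] at this
  by_cases hr : r = b
  · subst hr
    simpa [bump, hb, htb.symm] using this
  · by_cases hrt : r = t
    · subst hrt
      simpa [bump, hr, ht] using this
    · simpa [bump, hr, hrt] using this

theorem card_move {S : N → Finset R} {i : N} {t b : R} (ht : t ∈ S i) (hb : b ∉ S i) (j : N) :
    (Function.update S i (insert b ((S i).erase t)) j).card = (S j).card := by
  by_cases hj : j = i
  · subst hj
    rw [Function.update_self, Finset.card_insert_of_notMem (by grind), Finset.card_erase_of_mem ht]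
    have : 0 < (S j).card := Finset.card_pos.2 ⟨t, ht⟩
    omega
  · rw [Function.update_of_ne hj]

theorem potential_move [Fintype R] (G : MixedGame N R) {S : N → Finset R} {k : R → ℕ} {i : N}
    {t b : R} (ht : t ∈ S i) (hb : b ∉ S i) (hlt : G.key i b (k b + 1) < G.key i t (k t + 1)) :
    G.potential k (Function.update S i (insert b ((S i).erase t))) < G.potential k S := by
  unfold potential
  refine Finset.sum_lt_sum (fun j _ => ?_) ⟨i, Finset.mem_univ i, ?_⟩
  · by_cases hj : j = i
    · subst hj
      rw [Function.update_self, Finset.sum_insert (by grind), ← Finset.add_sum_erase _ _ ht]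
      refine Nat.add_le_add_right (Finset.card_le_card fun r hr => ?_) _
      simp only [Finset.mem_filter, Finset.mem_univ, true_and] at hr ⊢
      exact hr.trans hlt
    · rw [Function.update_of_ne hj]
  · rw [Function.update_self, Finset.sum_insert (by grind), ← Finset.add_sum_erase _ _ ht]
    refine Nat.add_lt_add_right (Finset.card_lt_card ⟨fun r hr => ?_, fun h => ?_⟩) _
    · simp only [Finset.mem_filter, Finset.mem_univ, true_and] at hr ⊢
      exact hr.trans hlt
    -- The rank drops strictly since `b` is counted in the rank of `t` but not in its own.
    · have := h (show b ∈ _ by simpa using hlt)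
      simp at this

/-- Absorbing the token raises prices at `t` only. This makes alternatives no cheaper, and those who
use `t` are content by `hstay`. -/
theorem IsStableAt.settle {G : MixedGame N R} {S : N → Finset R} {k : R → ℕ}
    (hst : G.IsStableAt S k) {t : R}
    (hstay : ∀ i, t ∈ S i → ∀ c ∉ S i, G.Indep i (insert c ((S i).erase t)) →
      G.key i t (k t + 1) ≤ G.key i c (k c + 1)) :
    G.IsStableAt S (bump k t) := by
  refine fun i => ⟨(hst i).1, fun a ha b hb hI => ?_⟩
  have h1 : G.key i b (k b + 1) ≤ G.key i b (bump k t b + 1) :=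
    G.key_mono i b (by simp [bump])
  refine le_trans ?_ h1
  by_cases hat : a = t
  · subst hat
    simpa [bump] using hstay i ha b hb hI
  · simpa [bump, hat] using (hst i).2 a ha b hb hI

/-! ## Existence of equilibria -/

/-- The base congestion `k` is constant throughout the induction, so the ranks that define the
potential never change while the token wanders. -/
theorem exists_settled [Fintype R] {G : MixedGame N R} (hG : ∀ i, IsIndepFamily (G.Indep i))
    {k : R → ℕ} (S : N → Finset R) (t : R) (hst : G.IsStableAt S k)
    (hk : congestion S = bump k t) :
    ∃ S', G.IsStableAt S' (congestion S') ∧ ∀ i, (S' i).card = (S i).card := by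
  classical
  induction hφ : G.potential k S using Nat.strong_induction_on generalizing S t with
  | _ φ ih =>
    by_cases hstay : ∀ i, t ∈ S i → ∀ c ∉ S i, G.Indep i (insert c ((S i).erase t)) →
      G.key i t (k t + 1) ≤ G.key i c (k c + 1)
    · exact ⟨S, hk ▸ hst.settle hstay, fun _ => rfl⟩
    · push Not at hstay
      obtain ⟨i, ht, c, hc, hIc, hlt⟩ := hstay
      obtain ⟨b, hb, hmin⟩ := Finset.exists_min_image
        (Finset.univ.filter fun c => c ∉ S i ∧ G.Indep i (insert c ((S i).erase t)))
        (fun c => G.key i c (k c + 1)) ⟨c, by simp [hc, hIc]⟩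
      simp only [Finset.mem_filter, Finset.mem_univ, true_and, and_imp] at hb hmin
      have hbt := (hmin c hc hIc).trans_lt hlt
      obtain ⟨S', h1, h2⟩ := ih _ (hφ ▸ G.potential_move ht hb.1 hbt) _ b
        (hst.move hG ht hb.1 hb.2 hbt hmin) (congestion_move hk ht hb.1) rfl
      exact ⟨S', h1, fun j => (h2 j).trans (card_move ht hb.1 j)⟩

theorem exists_stable_maximal [Fintype R] {G : MixedGame N R}
    (hG : ∀ i, IsIndepFamily (G.Indep i)) (S : N → Finset R)
    (hst : G.IsStableAt S (congestion S)) :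
    ∃ S', G.IsStableAt S' (congestion S') ∧ ∀ i X, G.Indep i X → X.card ≤ (S' i).card := by
  classical
  induction hd : Fintype.card N * Fintype.card R - ∑ i, (S i).card
    using Nat.strong_induction_on generalizing S with
  | _ d ih =>
    by_cases hmax : ∀ i X, G.Indep i X → X.card ≤ (S i).card
    · exact ⟨S, hst, hmax⟩
    · have hmax' : ∃ i, ∃ c ∉ S i, G.Indep i (insert c (S i)) := by
        by_contra! h
        exact hmax fun i => (hG i).card_le_of_maximal (hst i).1 (h i)
      obtain ⟨i, c, hc, hIc⟩ := hmax'
      obtain ⟨b, hb, hmin⟩ := Finset.exists_min_image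
        (Finset.univ.filter fun c => c ∉ S i ∧ G.Indep i (insert c (S i)))
        (fun c => G.key i c (congestion S c + 1)) ⟨c, by simp [hc, hIc]⟩
      simp only [Finset.mem_filter, Finset.mem_univ, true_and, and_imp] at hb hmin
      obtain ⟨S', h1, h2⟩ := exists_settled hG _ b (hst.add_resource hG hb.1 hb.2 hmin)
        (congestion_insert rfl hb.1)
      have h3 : ∑ j, (S j).card < ∑ j, (S' j).card := by
        refine Finset.sum_lt_sum (fun j _ => ?_) ⟨i, Finset.mem_univ i, ?_⟩
        · rw [h2 j]
          by_cases hj : j = i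
          · subst hj
            rw [Function.update_self]
            exact Finset.card_le_card (Finset.subset_insert _ _)
          · rw [Function.update_of_ne hj]
        · rw [h2 i, Function.update_self, Finset.card_insert_of_notMem hb.1]
          exact Nat.lt_succ_self _
      -- Without this bound the truncated difference used as induction measure might not drop.
      have h4 : ∑ j, (S' j).card ≤ Fintype.card N * Fintype.card R := by
        simpa using Finset.sum_le_card_nsmul Finset.univ (fun j => (S' j).card) (Fintype.card R)
          fun j _ => Finset.card_le_univ _
      exact ih _ (by omega) S' h1 rfl

theorem isStableAt_empty (G : MixedGame N R) (k : R → ℕ) : G.IsStableAt (fun _ => ∅) k :=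
  fun i => ⟨G.indep_empty i, fun a ha => absurd ha (Finset.notMem_empty a)⟩

theorem IsTractable.exists_isPNE [Fintype R] {G : MixedGame N R} (h : G.IsTractable) :
    ∃ S, G.IsPNE S := by
  obtain ⟨S, hst, hmax⟩ := exists_stable_maximal h.isIndepFamily _ (G.isStableAt_empty _)
  exact ⟨S, h.isPNE hst hmax⟩

end MixedGame

namespace Ram

/-! ## Time-bounded total correctness of programs -/

theorem one_le_bits (z : ℤ) : 1 ≤ bits z := Nat.le_add_left _ _

theorem bits_le_iff {z : ℤ} {k : ℕ} : bits z ≤ k + 1 ↔ z.natAbs < 2 ^ k := by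
  rw [bits, Nat.add_le_add_iff_right, Nat.size_le]

theorem natAbs_lt_two_pow (z : ℤ) : z.natAbs < 2 ^ (bits z - 1) := by
  simpa [bits] using Nat.lt_size_self z.natAbs

theorem bits_of_natAbs_le_add {x y z : ℤ} (h : z.natAbs ≤ x.natAbs + y.natAbs) :
    bits z ≤ bits x + bits y := by
  have hx := natAbs_lt_two_pow x
  have hy := natAbs_lt_two_pow y
  have h1 := one_le_bits x
  have h2 := one_le_bits y
  obtain ⟨a, ha⟩ : ∃ a, bits x = a + 1 := ⟨bits x - 1, by omega⟩
  obtain ⟨b, hb⟩ : ∃ b, bits y = b + 1 := ⟨bits y - 1, by omega⟩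
  rw [ha, hb, show a + 1 + (b + 1) = (a + b + 1) + 1 by ring, bits_le_iff]
  rw [ha] at hx
  rw [hb] at hy
  have h3 : 2 ^ a ≤ 2 ^ (a + b) := Nat.pow_le_pow_right (by norm_num) (by omega)
  have h4 : 2 ^ b ≤ 2 ^ (a + b) := Nat.pow_le_pow_right (by norm_num) (by omega)
  simp only [Nat.add_sub_cancel] at hx hy
  rw [pow_succ]
  omega

theorem bits_add (x y : ℤ) : bits (x + y) ≤ bits x + bits y :=
  bits_of_natAbs_le_add (Int.natAbs_add_le x y)

theorem bits_sub (x y : ℤ) : bits (x - y) ≤ bits x + bits y :=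
  bits_of_natAbs_le_add (Int.natAbs_sub_le x y)

theorem bits_mul (x y : ℤ) : bits (x * y) ≤ bits x + bits y := by
  have hx := natAbs_lt_two_pow x
  have hy := natAbs_lt_two_pow y
  have h1 := one_le_bits x
  have h2 := one_le_bits y
  obtain ⟨a, ha⟩ : ∃ a, bits x = a + 1 := ⟨bits x - 1, by omega⟩
  obtain ⟨b, hb⟩ : ∃ b, bits y = b + 1 := ⟨bits y - 1, by omega⟩
  rw [ha] at hx
  rw [hb] at hy
  simp only [Nat.add_sub_cancel] at hx hy
  have h3 : bits (x * y) ≤ (a + b) + 1 := by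
    rw [bits_le_iff, Int.natAbs_mul, pow_add]
    exact Nat.mul_lt_mul'' hx hy
  omega

theorem bits_natCast_le (k : ℕ) : bits (k : ℤ) ≤ k + 1 := by
  rw [bits_le_iff, Int.natAbs_natCast]
  exact Nat.lt_two_pow_self

/-- All cells contain numbers of at most `B` bits. -/
def Bounded (B : ℕ) (M : Mem) : Prop := ∀ t a b, bits (M t a b) ≤ B

theorem Bounded.set {B : ℕ} {M : Mem} (h : Bounded B M) (t : ℕ) (a b : ℤ) {z : ℤ}
    (hz : bits z ≤ B) : Bounded B (M.set t a b z) := by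
  intro t' a' b'
  unfold Mem.set
  split_ifs
  · exact hz
  · exact h t' a' b'

/-- A factor by which the value of an expression can be longer than the cells. -/
def Exp.width : Exp → ℕ
  | const z => bits z
  | read _ _ _ => 1
  | add x y => x.width + y.width
  | sub x y => x.width + y.width
  | mul x y => x.width + y.width

/-- A factor that bounds the evaluation time of an expression in terms of the cell length. -/
def Exp.weight : Exp → ℕ
  | const z => bits z
  | read _ a b => a.weight + b.weight + 1
  | add x y => x.weight + y.weight + (x.width + y.width)
  | sub x y => x.weight + y.weight + (x.width + y.width)
  | mul x y => x.weight + y.weight + (x.width + y.width)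

/-- Bit length is subadditive under sums, differences and products alike, so the value is longer
than a cell by at most a factor that depends on the expression alone. -/
theorem Exp.bits_val_le {B : ℕ} {M : Mem} (hB : 2 ≤ B) (h : Bounded B M) (e : Exp) :
    bits (e.val M) ≤ e.width * B := by
  induction e with
  | const z => exact Nat.le_mul_of_pos_right _ (by omega)
  | read t a b => simpa [Exp.val, Exp.width] using h _ _ _
  | add x y hx hy => rw [Exp.width, add_mul]; exact (bits_add _ _).trans (add_le_add hx hy)
  | sub x y hx hy => rw [Exp.width, add_mul]; exact (bits_sub _ _).trans (add_le_add hx hy)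
  | mul x y hx hy => rw [Exp.width, add_mul]; exact (bits_mul _ _).trans (add_le_add hx hy)

theorem Exp.time_le {B : ℕ} {M : Mem} (hB : 2 ≤ B) (h : Bounded B M) (e : Exp) :
    e.time M ≤ e.weight * B := by
  induction e with
  | const z => exact Nat.le_mul_of_pos_right _ (by omega)
  | read t a b ha hb =>
    have := Exp.bits_val_le hB h (.read t a b)
    simp only [Exp.time, Exp.weight, Exp.width, add_mul] at *
    omega
  | add x y hx hy =>
    have := Exp.bits_val_le hB h (.add x y)
    simp only [Exp.time, Exp.weight, Exp.width, add_mul] at *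
    omega
  | sub x y hx hy =>
    have := Exp.bits_val_le hB h (.sub x y)
    simp only [Exp.time, Exp.weight, Exp.width, add_mul] at *
    omega
  | mul x y hx hy =>
    have := Exp.bits_val_le hB h (.mul x y)
    simp only [Exp.time, Exp.weight, Exp.width, add_mul] at *
    omega

/-- A polynomial in the maximal number of iterations of a loop that bounds the time of a program,
up to a factor for the length of the cells and the queries. -/
noncomputable def Prog.weight : Prog → Polynomial ℕ
  | .skip => 1
  | .write _ a b e => (1 + a.weight + b.weight + e.weight : ℕ)
  | .seq p q => 1 + p.weight + q.weight
  | .ite e p q => 1 + ((e.weight : ℕ) : Polynomial ℕ) + p.weight + q.weight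
  -- One test more than there are iterations.
  | .while e p => (Polynomial.X + 1) * (1 + ((e.weight : ℕ) : Polynomial ℕ) + p.weight)
  | .query _ e _ a len => (2 + e.weight + a.weight + len.weight : ℕ)

/-- Started in the memory `M` with cells of at most `B` bits, the program halts in a memory with
cells of at most `B` bits that satisfies `Q`, and does so in the time that is due if queries have
length at most `l` and loops have at most `L` iterations. -/
def Runs (O : Oracle) (B l L : ℕ) (p : Prog) (M : Mem) (Q : Mem → Prop) : Prop :=
  2 ≤ B → Bounded B M → ∃ c M', Exec O p M c M' ∧ c ≤ p.weight.eval L * (B * (l + 1)) ∧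
    Bounded B M' ∧ Q M'

namespace Runs

variable {O : Oracle} {B l L : ℕ} {p q : Prog} {e : Exp} {M : Mem} {Q Q' : Mem → Prop}

theorem imp (h : Runs O B l L p M Q) (hQ : ∀ M', Q M' → Q' M') : Runs O B l L p M Q' := by
  intro hB hM
  obtain ⟨c, M', h1, h2, h3, h4⟩ := h hB hM
  exact ⟨c, M', h1, h2, h3, hQ M' h4⟩

theorem skip (h : Q M) : Runs O B l L .skip M Q := by
  intro hB hM
  refine ⟨1, M, .skip M, ?_, hM, h⟩
  have : 1 * 1 ≤ B * (l + 1) := Nat.mul_le_mul (by omega) (by omega)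
  simpa [Prog.weight] using this

theorem write {t : ℕ} {a b : Exp} (hb : bits (e.val M) ≤ B)
    (h : Q (M.set t (a.val M) (b.val M) (e.val M))) : Runs O B l L (.write t a b e) M Q := by
  intro hB hM
  refine ⟨_, _, .write M t a b e, ?_, hM.set t _ _ hb, h⟩
  have h1 := a.time_le hB hM
  have h2 := b.time_le hB hM
  have h3 := e.time_le hB hM
  simp only [Prog.weight, Polynomial.eval_natCast]
  calc _ ≤ (1 + a.weight + b.weight + e.weight) * B := by
        simp only [add_mul]
        omega
    _ ≤ _ := by
        rw [Nat.cast_id]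
        exact Nat.mul_le_mul_left _ (Nat.le_mul_of_pos_right _ (by omega))

theorem seq (h : Runs O B l L p M fun M' => Runs O B l L q M' Q) :
    Runs O B l L (.seq p q) M Q := by
  intro hB hM
  obtain ⟨c, M', h1, h2, h3, h4⟩ := h hB hM
  obtain ⟨c', M'', h5, h6, h7, h8⟩ := h4 hB h3
  refine ⟨_, M'', .seq h1 h5, ?_, h7, h8⟩
  have : 1 * 1 ≤ B * (l + 1) := Nat.mul_le_mul (by omega) (by omega)
  simp only [Prog.weight, Polynomial.eval_add, Polynomial.eval_one, add_mul]
  omega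

theorem ite (hp : 0 < e.val M → Runs O B l L p M Q) (hq : ¬ 0 < e.val M → Runs O B l L q M Q) :
    Runs O B l L (.ite e p q) M Q := by
  intro hB hM
  have h0 : 1 * 1 ≤ B * (l + 1) := Nat.mul_le_mul (by omega) (by omega)
  have h1 : e.time M ≤ e.weight * (B * (l + 1)) :=
    (e.time_le hB hM).trans (Nat.mul_le_mul_left _ (Nat.le_mul_of_pos_right _ (by omega)))
  by_cases he : 0 < e.val M
  · obtain ⟨c, M', h2, h3, h4, h5⟩ := hp he hB hM
    refine ⟨_, M', .ite_pos he h2, ?_, h4, h5⟩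
    simp only [Prog.weight, Polynomial.eval_add, Polynomial.eval_one, Polynomial.eval_natCast,
      add_mul, Nat.cast_id]
    omega
  · obtain ⟨c, M', h2, h3, h4, h5⟩ := hq he hB hM
    refine ⟨_, M', .ite_neg he h2, ?_, h4, h5⟩
    simp only [Prog.weight, Polynomial.eval_add, Polynomial.eval_one, Polynomial.eval_natCast,
      add_mul, Nat.cast_id]
    omega

theorem query {d t : ℕ} {a len : Exp} (hl : len.val M ≤ l)
    (h1 : O (e.val M) (M.rowList t (a.val M) (len.val M)) → Q (M.set d 0 0 1))
    (h0 : ¬ O (e.val M) (M.rowList t (a.val M) (len.val M)) → Q (M.set d 0 0 0)) :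
    Runs O B l L (.query d e t a len) M Q := by
  intro hB hM
  refine ⟨_, _, .query M d e t a len, ?_, ?_, ?_⟩
  · have h1 := a.time_le hB hM
    have h2 := len.time_le hB hM
    have h3 := e.time_le hB hM
    have h4 : ((M.rowList t (a.val M) (len.val M)).map bits).sum ≤ l * B := by
      refine (List.sum_le_card_nsmul _ B ?_).trans ?_
      · intro x hx
        obtain ⟨z, hz, rfl⟩ := List.mem_map.1 hx
        obtain ⟨k, -, rfl⟩ := List.mem_map.1 hz
        exact hM _ _ _
      · rw [smul_eq_mul]
        refine Nat.mul_le_mul_right _ ?_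
        simp [Mem.rowList, hl]
    simp only [Prog.weight, Polynomial.eval_natCast]
    calc _ ≤ (1 + e.weight + a.weight + len.weight) * B + l * B := by
          simp only [add_mul]
          omega
      -- The queried list has at most `l` entries of at most `B` bits, which accounts for the second
      -- unit in the weight of a query.
      _ ≤ (1 + e.weight + a.weight + len.weight) * (B * (l + 1)) + 1 * (B * (l + 1)) := by
          refine add_le_add (Nat.mul_le_mul_left _ (Nat.le_mul_of_pos_right _ (by omega))) ?_
          rw [one_mul, mul_comm]
          exact Nat.mul_le_mul_left _ (by omega)
      _ = _ := by
          rw [Nat.cast_id]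
          ring
  · refine hM.set d 0 0 ?_
    split_ifs
    · exact le_trans (by decide) hB
    · exact le_trans (by decide) hB
  · split_ifs with h
    · exact h1 h
    · exact h0 h

/-- The index of the invariant is a variant: it may drop by any positive amount and bounds the
number of remaining iterations. -/
theorem while_loop (I : ℕ → Mem → Prop) {k : ℕ}
    (hstep : ∀ k M, I k M → 0 < e.val M → Runs O B l L p M fun M' => ∃ k' < k, I k' M')
    (hdone : ∀ k M, I k M → ¬ 0 < e.val M → Q M) (hI : I k M) (hk : k ≤ L) :
    Runs O B l L (.while e p) M Q := by
  have key : ∀ k M, I k M → 2 ≤ B → Bounded B M → ∃ c M', Exec O (.while e p) M c M' ∧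
      c ≤ ((k + 1) * (1 + e.weight + p.weight.eval L)) * (B * (l + 1)) ∧
      Bounded B M' ∧ Q M' := by
    intro k
    induction k using Nat.strong_induction_on with
    | _ k ih =>
      intro M hI hB hM
      have h0 : 1 * 1 ≤ B * (l + 1) := Nat.mul_le_mul (by omega) (by omega)
      have h1 : e.time M ≤ e.weight * (B * (l + 1)) :=
        (e.time_le hB hM).trans (Nat.mul_le_mul_left _ (Nat.le_mul_of_pos_right _ (by omega)))
      by_cases he : 0 < e.val M
      · obtain ⟨c, M', h2, h3, h4, k', hk', h5⟩ := hstep k M hI he hB hM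
        obtain ⟨c', M'', h6, h7, h8, h9⟩ := ih k' hk' M' h5 hB h4
        refine ⟨_, M'', .while_step he h2 h6, ?_, h8, h9⟩
        calc _ ≤ (1 + e.weight + p.weight.eval L) * (B * (l + 1)) +
              ((k' + 1) * (1 + e.weight + p.weight.eval L)) * (B * (l + 1)) := by
              refine add_le_add ?_ h7
              simp only [add_mul]
              omega
          _ = ((k' + 1 + 1) * (1 + e.weight + p.weight.eval L)) * (B * (l + 1)) := by ring
          _ ≤ _ := by
              refine Nat.mul_le_mul_right _ (Nat.mul_le_mul_right _ ?_)
              omega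
      · refine ⟨_, M, .while_done he, ?_, hM, hdone k M hI he⟩
        calc _ ≤ (1 * (1 + e.weight + p.weight.eval L)) * (B * (l + 1)) := by
              rw [one_mul]
              simp only [add_mul]
              omega
          _ ≤ _ := by
              refine Nat.mul_le_mul_right _ (Nat.mul_le_mul_right _ ?_)
              omega
  intro hB hM
  obtain ⟨c, M', h1, h2, h3, h4⟩ := key k M hI hB hM
  refine ⟨c, M', h1, h2.trans ?_, h3, h4⟩
  simp only [Prog.weight, Polynomial.eval_add, Polynomial.eval_one, Polynomial.eval_natCast,
    Polynomial.eval_mul, Polynomial.eval_X, Nat.cast_id]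
  refine Nat.mul_le_mul_right _ (Nat.mul_le_mul_right _ ?_)
  omega

end Runs

end Ram

namespace Ram

/-! ## The search for the best resource -/

@[simp]
theorem table_apply {n m : ℕ} (f : Fin n → Fin m → ℤ) (i : Fin n) (j : Fin m) :
    table f i j = f i j := by
  have hi := i.2
  have hj := j.2
  rw [table, dif_pos (by omega)]
  rfl

theorem Mem.set_of_ne (M : Mem) {t t' : ℕ} (h : t' ≠ t) (a b z : ℤ) : M.set t a b z t' = M t' := by
  funext a' b'
  simp [Mem.set, h]

/-- The cell `(0, 0)` of a table. -/
abbrev Exp.cell (t : ℕ) : Exp := .read t (.const 0) (.const 0)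

/-- Store the value of `e` in the cell `(0, 0)` of table `t`. -/
abbrev Prog.setCell (t : ℕ) (e : Exp) : Prog := .write t (.const 0) (.const 0) e

/-- The number of players. -/
abbrev Exp.players : Exp := .cell 0

/-- The number of resources. -/
abbrev Exp.resources : Exp := .read 0 (.const 0) (.const 1)

/-- The entry of the row of resource `x` in table `t` that belongs to one more user than given by
table `8`. -/
abbrev Exp.next (t : ℕ) (x : Exp) : Exp := .read t x (.read 8 (.const 0) x)

/-- The numerator of the cost of the resource `x` for the player in table `11`, where the
denominator of the preference value is left out. -/
def Exp.keyNum (x : Exp) : Exp :=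
  .add (.mul (.read 1 (.cell 11) (.const 0)) (.mul (.next 3 x) (.next 6 x)))
    (.mul (.sub (.read 2 (.cell 11) (.const 0)) (.read 1 (.cell 11) (.const 0)))
      (.mul (.next 5 x) (.next 4 x)))

/-- The product of the denominators of the costs of the resource `x`. -/
def Exp.keyDen (x : Exp) : Exp := .mul (.next 4 x) (.next 6 x)

/-- An expression that is positive if the resource `x` is cheaper than the resource `y`. -/
def Exp.less (x y : Exp) : Exp := .sub (.mul y.keyNum x.keyDen) (.mul x.keyNum y.keyDen)

/-- One round of the search: try the resource in table `13`. -/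
def Prog.tryResource : Prog :=
  .seq
    (.ite (.read 7 (.cell 11) (.cell 13)) .skip
      (.seq (.write 7 (.cell 11) (.cell 13) (.const 1))
        (.seq (.query 14 (.cell 11) 7 (.cell 11) .resources)
          (.seq (.write 7 (.cell 11) (.cell 13) (.const 0))
            (.ite (.cell 14)
              (.ite (.add (.cell 12) (.const 1))
                (.ite (.less (.cell 13) (.cell 12)) (.setCell 12 (.cell 13)) .skip)
                (.setCell 12 (.cell 13)))
              .skip)))))
    (.setCell 13 (.add (.cell 13) (.const 1)))

/-- Search for the cheapest resource that the player in table `11` can add to its row of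
table `7`. The result is left in table `12`, whose content before the search is the candidate
to start with, or `-1`. -/
def Prog.findBest : Prog :=
  .seq (.setCell 13 (.const 0)) (.while (.sub .resources (.cell 13)) .tryResource)

end Ram

open Ram

/-! ### Correctness of the price comparison and of the search -/

namespace MixedGame

variable {n m : ℕ} {G : MixedGame (Fin n) (Fin m)} {q : RatData n m}

theorem key_eq_div (hq : q.Specifies G) (j : Fin n) (r : Fin m) (k : Fin n) :
    G.key j r (k + 1) =
      (((q.pref j).num * ((q.lat r k).num * (q.bot r k).den) +
          ((q.pref j).den - (q.pref j).num) * ((q.bot r k).num * (q.lat r k).den) : ℤ) : ℝ) /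
        ((q.pref j).den * ((q.lat r k).den * (q.bot r k).den : ℤ) : ℝ) := by
  have hk : clampCong (Fin n) (k + 1) = k + 1 :=
    clampCong_of_mem ⟨by omega, by simp⟩
  have h1 : ((q.pref j).den : ℝ) ≠ 0 := by exact_mod_cast (q.pref j).den_ne_zero
  have h2 : ((q.lat r k).den : ℝ) ≠ 0 := by exact_mod_cast (q.lat r k).den_ne_zero
  have h3 : ((q.bot r k).den : ℝ) ≠ 0 := by exact_mod_cast (q.bot r k).den_ne_zero
  rw [key, hk, (hq.2 r k).1, (hq.2 r k).2, hq.1 j, Rat.cast_def, Rat.cast_def (q.lat r k),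
    Rat.cast_def (q.bot r k)]
  push_cast
  field_simp

/-- Column `k r` of a cost table holds the cost at congestion `k r + 1`, which is the cost for one
more user. The bounds `k r < n` and `k s < n` keep the access inside the table. -/
theorem less_pos_iff (hq : q.Specifies G) {M : Mem} (hM : ∀ t ≤ 6, M t = q.input t) {j : Fin n}
    (hj : M 11 0 0 = j) {k : Fin m → ℕ} (hk : ∀ r : Fin m, M 8 0 r = k r) {x y : Exp} {r s : Fin m}
    (hx : x.val M = r) (hy : y.val M = s) (hr : k r < n) (hs : k s < n) :
    0 < (Exp.less x y).val M ↔ G.key j r (k r + 1) < G.key j s (k s + 1) := by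
  have er := key_eq_div hq j r ⟨k r, hr⟩
  have es := key_eq_div hq j s ⟨k s, hs⟩
  simp only at er es
  rw [er, es]
  have hd : ∀ z : ℚ, (0 : ℝ) < z.den := fun z => by exact_mod_cast z.den_pos
  have hd' : ∀ z : ℚ, (0 : ℤ) < z.den := fun z => by exact_mod_cast z.den_pos
  have t1 : M 1 j 0 = (q.pref j).num := by
    rw [hM 1 (by norm_num)]
    exact table_apply (m := 1) (fun i _ => (q.pref i).num) j 0
  have t2 : M 2 j 0 = (q.pref j).den := by
    rw [hM 2 (by norm_num)]
    exact table_apply (m := 1) (fun i _ => ((q.pref i).den : ℤ)) j 0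
  have t3 : ∀ (r : Fin m) (h : k r < n), M 3 r (k r) = (q.lat r ⟨k r, h⟩).num := by
    intro r h
    rw [hM 3 (by norm_num)]
    exact table_apply (fun r k => (q.lat r k).num) r ⟨k r, h⟩
  have t4 : ∀ (r : Fin m) (h : k r < n), M 4 r (k r) = (q.lat r ⟨k r, h⟩).den := by
    intro r h
    rw [hM 4 (by norm_num)]
    exact table_apply (fun r k => ((q.lat r k).den : ℤ)) r ⟨k r, h⟩
  have t5 : ∀ (r : Fin m) (h : k r < n), M 5 r (k r) = (q.bot r ⟨k r, h⟩).num := by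
    intro r h
    rw [hM 5 (by norm_num)]
    exact table_apply (fun r k => (q.bot r k).num) r ⟨k r, h⟩
  have t6 : ∀ (r : Fin m) (h : k r < n), M 6 r (k r) = (q.bot r ⟨k r, h⟩).den := by
    intro r h
    rw [hM 6 (by norm_num)]
    exact table_apply (fun r k => ((q.bot r k).den : ℤ)) r ⟨k r, h⟩
  simp only [Exp.less, Exp.keyNum, Exp.keyDen, Exp.val, hx, hy, hj, t1, t2, hk, t3 r hr, t3 s hs,
    t4 r hr, t4 s hs, t5 r hr, t5 s hs, t6 r hr, t6 s hs]
  -- Both prices share the positive denominator of the preference value, which cancels; the rest is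
  -- cross-multiplication.
  rw [sub_pos, ← div_div, ← div_div, div_right_comm,
    div_right_comm (c := (((q.lat s _).den * _ : ℤ) : ℝ)), div_lt_div_iff_of_pos_right (hd _),
    div_lt_div_iff₀ (by exact_mod_cast mul_pos (hd' _) (hd' _))
      (by exact_mod_cast mul_pos (hd' _) (hd' _))]
  exact_mod_cast Iff.rfl

/-- Independence according to the first `m` entries of a row. -/
theorem indepOracle_iff {M : Mem} {j : Fin n} {X : Finset (Fin m)}
    (h : ∀ r : Fin m, M 7 j r ≠ 0 ↔ r ∈ X) :
    G.indepOracle j (M.rowList 7 j m) ↔ G.Indep j X := by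
  have hget : ∀ r : Fin m, (M.rowList 7 j m).getD r 0 = M 7 j r := by
    intro r
    have hmap : (List.range m).flatMap (fun a : ℕ => [(a : ℤ)]) =
        (List.range m).map fun a : ℕ => (a : ℤ) := List.map_eq_flatMap.symm
    simp [Mem.rowList, hmap]
  simp only [indepOracle, hget, h, Indep, Finset.subset_iff]
  constructor
  · rintro ⟨i, hi, hs⟩
    obtain rfl : i = j := Fin.ext (by exact_mod_cast hi)
    exact hs
  · exact fun hs => ⟨j, rfl, hs⟩

/-- `d` is the cheapest of the resources below `x` that player `j` can add to `X`, where the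
candidate `init` is kept unless there is a cheaper one; if there is none at all, `d` is `-1`. -/
def IsBestBelow (G : MixedGame (Fin n) (Fin m)) (k : Fin m → ℕ) (j : Fin n) (X : Finset (Fin m))
    (init : ℤ) (x : ℕ) (d : ℤ) : Prop :=
  (d = -1 ∧ init = -1 ∧ ∀ c : Fin m, (c : ℕ) < x → c ∉ X → ¬ G.Indep j (insert c X)) ∨
    ∃ b : Fin m, d = b ∧ b ∉ X ∧ G.Indep j (insert b X) ∧
      (∀ c : Fin m, (c : ℕ) < x → c ∉ X → G.Indep j (insert c X) →
        G.key j b (k b + 1) ≤ G.key j c (k c + 1)) ∧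
      (d = init ∨ ∀ t : Fin m, init = t → G.key j b (k b + 1) < G.key j t (k t + 1))

theorem IsBestBelow.succ_of_not {k : Fin m → ℕ} {j : Fin n} {X : Finset (Fin m)} {init d : ℤ}
    {x : Fin m} (h : G.IsBestBelow k j X init x d) (hx : x ∉ X → ¬ G.Indep j (insert x X)) :
    G.IsBestBelow k j X init (x + 1) d := by
  have hc : ∀ c : Fin m, (c : ℕ) < x + 1 → (c : ℕ) < x ∨ c = x := by
    intro c hc
    rw [Fin.ext_iff]
    omega
  rcases h with ⟨h1, h2, h3⟩ | ⟨b, h1, h2, h3, h4, h5⟩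
  · refine Or.inl ⟨h1, h2, fun c hcx => ?_⟩
    rcases hc c hcx with h | rfl
    · exact h3 c h
    · exact hx
  · refine Or.inr ⟨b, h1, h2, h3, fun c hcx => ?_, h5⟩
    rcases hc c hcx with h | rfl
    · exact h4 c h
    · exact fun h h' => absurd h' (hx h)

theorem IsBestBelow.succ_of_le {k : Fin m → ℕ} {j : Fin n} {X : Finset (Fin m)} {init d : ℤ}
    {x b : Fin m} (h : G.IsBestBelow k j X init x d) (hd : d = b)
    (hle : G.key j b (k b + 1) ≤ G.key j x (k x + 1)) :
    G.IsBestBelow k j X init (x + 1) d := by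
  rcases h with ⟨h1, -⟩ | ⟨b', h1, h2, h3, h4, h5⟩
  · omega
  · obtain rfl : b = b' := Fin.ext (by omega)
    refine Or.inr ⟨b, h1, h2, h3, fun c hcx => ?_, h5⟩
    rcases (show (c : ℕ) < x ∨ c = x by rw [Fin.ext_iff]; omega) with h | rfl
    · exact h4 c h
    · exact fun _ _ => hle

theorem IsBestBelow.replace {k : Fin m → ℕ} {j : Fin n} {X : Finset (Fin m)} {init d : ℤ}
    {x : Fin m} (h : G.IsBestBelow k j X init x d) (hx : x ∉ X) (hI : G.Indep j (insert x X))
    (hlt : ∀ b : Fin m, d = b → G.key j x (k x + 1) < G.key j b (k b + 1)) :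
    G.IsBestBelow k j X init (x + 1) x := by
  have hc : ∀ c : Fin m, (c : ℕ) < x + 1 → (c : ℕ) < x ∨ c = x := by
    intro c hc
    rw [Fin.ext_iff]
    omega
  rcases h with ⟨h1, h2, h3⟩ | ⟨b, h1, h2, h3, h4, h5⟩
  · refine Or.inr ⟨x, rfl, hx, hI, fun c hcx => ?_, Or.inr fun t ht => by omega⟩
    rcases hc c hcx with h | rfl
    · exact fun h' h'' => absurd h'' (h3 c h h')
    · exact fun _ _ => le_rfl
  · have hb := hlt b h1
    refine Or.inr ⟨x, rfl, hx, hI, fun c hcx => ?_, Or.inr fun t ht => ?_⟩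
    · rcases hc c hcx with h | rfl
      · exact fun h' h'' => hb.le.trans (h4 c h h' h'')
      · exact fun _ _ => le_rfl
    · rcases h5 with h5 | h5
      · obtain rfl : b = t := Fin.ext (by omega)
        exact hb
      · exact hb.trans (h5 t ht)

theorem runs_tryResource (hq : q.Specifies G) {O : Oracle} (hO : O = G.indepOracle) {B L : ℕ}
    (hB : n + m + 2 ≤ B) {M : Mem} (hM : ∀ t ≤ 6, M t = q.input t) {j : Fin n}
    (hj : M 11 0 0 = j) {k : Fin m → ℕ} (hk : ∀ r : Fin m, M 8 0 r = k r) {X : Finset (Fin m)}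
    (hX : ∀ r : Fin m, M 7 j r = if r ∈ X then 1 else 0) (hkn : ∀ r ∉ X, k r < n) {init : ℤ}
    {x : Fin m} (hx : M 13 0 0 = x) (hbest : G.IsBestBelow k j X init x (M 12 0 0)) :
    Runs O B m L .tryResource M fun M' =>
      (∀ t, t ≠ 12 → t ≠ 13 → t ≠ 14 → M' t = M t) ∧ M' 13 0 0 = (x + 1 : ℕ) ∧
        G.IsBestBelow k j X init (x + 1) (M' 12 0 0) := by
  subst hO
  have hxm := x.2
  have bx : bits ((x : ℕ) : ℤ) ≤ B := (bits_natCast_le _).trans (by omega)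
  have bx1 : bits (((x : ℕ) : ℤ) + 1) ≤ B := by
    have := bits_natCast_le (x + 1)
    push_cast at this
    omega
  have hm : M 0 0 1 = m := by
    rw [hM 0 (by norm_num)]
    exact table_apply (n := 1) (m := 2) (fun _ j => if j = 0 then (n : ℤ) else m) 0 1
  have finish : ∀ {M' : Mem}, (∀ t, t ≠ 12 → t ≠ 13 → t ≠ 14 → M' t = M t) → M' 13 0 0 = x →
      G.IsBestBelow k j X init (x + 1) (M' 12 0 0) →
      Runs G.indepOracle B m L (.setCell 13 (.add (.cell 13) (.const 1))) M' fun M' =>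
      (∀ t, t ≠ 12 → t ≠ 13 → t ≠ 14 → M' t = M t) ∧ M' 13 0 0 = (x + 1 : ℕ) ∧
        G.IsBestBelow k j X init (x + 1) (M' 12 0 0) := by
    intro M' h1 h2 h3
    refine Runs.write ?_ ⟨fun t h12 h13 h14 => ?_, ?_, ?_⟩
    · simpa [Exp.val, h2] using bx1
    · rw [Mem.set_of_ne _ h13, h1 t h12 h13 h14]
    · simp [Mem.set, Exp.val, h2]
    · simpa [Mem.set] using h3
  refine Runs.seq (Runs.ite (fun h => Runs.skip ?_) fun h => ?_)
  · refine finish (fun _ _ _ _ => rfl) hx (hbest.succ_of_not fun hxX => ?_)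
    simp [Exp.val, hj, hx, hX, hxX] at h
  have hxX : x ∉ X := by
    intro hxX
    simp [Exp.val, hj, hx, hX, hxX] at h
  have h7 : M 7 j x = 0 := by simp [hX, hxX]
  refine Runs.seq (Runs.write ((show bits 1 ≤ 2 by decide).trans (by omega)) ?_)
  simp only [Exp.val, hj, hx]
  set M1 := M.set 7 j x 1 with hM1
  have hor : G.indepOracle j (M1.rowList 7 j m) ↔ G.Indep j (insert x X) := by
    refine indepOracle_iff fun r => ?_
    by_cases hr : r = x
    · simp [hM1, Mem.set, hr]
    · have : ¬ ((r : ℕ) : ℤ) = ((x : ℕ) : ℤ) := fun h => hr (Fin.ext (by exact_mod_cast h))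
      rw [hM1, Mem.set, if_neg (fun h => this h.2.2), hX]
      simp [hr]
  have e11 : M1 11 0 0 = j := by rw [hM1, Mem.set_of_ne _ (by norm_num), hj]
  have e0 : M1 0 0 1 = m := by rw [hM1, Mem.set_of_ne _ (by norm_num), hm]
  -- The row of the player itself serves as the query list: `x` is marked for the query and then
  -- unmarked, which restores the table because its entry was `0`.
  have restore : ∀ z : ℤ, ∀ t, t ≠ 14 → ((M1.set 14 0 0 z).set 7 j x 0) t = M t := by
    intro z t ht
    by_cases h : t = 7
    · subst h
      funext a b
      simp only [hM1, Mem.set]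
      split_ifs <;> simp_all
    · rw [Mem.set_of_ne _ h, Mem.set_of_ne _ ht, hM1, Mem.set_of_ne _ h]
  have hwrite : bits 0 ≤ B := (show bits 0 ≤ 2 by decide).trans (by omega)
  refine Runs.seq (Runs.query (by simp [Exp.val, e0]) (fun hI => ?_) fun hI => ?_)
  all_goals
    simp only [Exp.val, e11, e0, hor] at hI
    refine Runs.seq (Runs.write (by simpa [Exp.val] using hwrite) ?_)
  · have e11' : (M1.set 14 0 0 1) 11 0 0 = j := by rw [Mem.set_of_ne _ (by norm_num), e11]
    have e13' : (M1.set 14 0 0 1) 13 0 0 = x := by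
      rw [Mem.set_of_ne _ (by norm_num), hM1, Mem.set_of_ne _ (by norm_num), hx]
    simp only [Exp.val, e11', e13']
    have hM2 := restore 1
    set M2 := (M1.set 14 0 0 1).set 7 j x 0 with hM2'
    have h12 : M2 12 0 0 = M 12 0 0 := by rw [hM2 12 (by norm_num)]
    have h13 : M2 13 0 0 = x := by rw [hM2 13 (by norm_num), hx]
    have h14 : M2 14 0 0 = 1 := by simp [hM2', Mem.set]
    have replace : (∀ b : Fin m, M 12 0 0 = b → G.key j x (k x + 1) < G.key j b (k b + 1)) →
        Runs G.indepOracle B m L (.setCell 12 (.cell 13)) M2 fun M' =>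
          Runs G.indepOracle B m L (.setCell 13 (.add (.cell 13) (.const 1))) M' fun M' =>
          (∀ t, t ≠ 12 → t ≠ 13 → t ≠ 14 → M' t = M t) ∧ M' 13 0 0 = (x + 1 : ℕ) ∧
            G.IsBestBelow k j X init (x + 1) (M' 12 0 0) := by
      intro hlt
      refine Runs.write (by simpa [Exp.val, h13] using bx) (finish (fun t t12 t13 t14 => ?_) ?_ ?_)
      · rw [Mem.set_of_ne _ t12, hM2 t t14]
      · rw [Mem.set_of_ne _ (by norm_num), h13]
      · simpa [Mem.set, Exp.val, h13] using hbest.replace hxX hI hlt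
    refine Runs.ite (fun _ => Runs.ite (fun hpos => ?_) fun hneg => ?_) fun h => ?_
    · simp only [Exp.val, h12] at hpos
      obtain ⟨b, hb, hbX⟩ : ∃ b : Fin m, M 12 0 0 = b ∧ b ∉ X := by
        rcases hbest with ⟨h1, -⟩ | ⟨b, h1, h2, -⟩
        · omega
        · exact ⟨b, h1, h2⟩
      have hless := less_pos_iff hq (M := M2) (fun t ht => by rw [hM2 t (by omega), hM t ht])
        (j := j) (by rw [hM2 11 (by norm_num), hj]) (k := k)
        (fun r => by rw [hM2 8 (by norm_num), hk]) (x := .cell 13) (y := .cell 12) (r := x) (s := b)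
        h13 (by simp [Exp.val, h12, hb]) (hkn x hxX) (hkn b hbX)
      refine Runs.ite (fun hl => replace fun b' hb' => ?_) fun hl => Runs.skip ?_
      · obtain rfl : b = b' := Fin.ext (by omega)
        exact hless.1 hl
      · refine finish (fun t _ _ t14 => hM2 t t14) h13 ?_
        rw [h12]
        exact hbest.succ_of_le hb (not_lt.1 (mt hless.2 hl))
    · refine replace fun b hb => ?_
      simp only [Exp.val, h12, hb] at hneg
      omega
    · simp [Exp.val, h14] at h
  · have e11' : (M1.set 14 0 0 0) 11 0 0 = j := by rw [Mem.set_of_ne _ (by norm_num), e11]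
    have e13' : (M1.set 14 0 0 0) 13 0 0 = x := by
      rw [Mem.set_of_ne _ (by norm_num), hM1, Mem.set_of_ne _ (by norm_num), hx]
    simp only [Exp.val, e11', e13']
    have hM2 := restore 0
    refine Runs.ite (fun h => ?_) fun _ => Runs.skip (finish (fun t _ _ t14 => hM2 t t14) ?_ ?_)
    · simp [Exp.val, Mem.set] at h
    · rw [hM2 13 (by norm_num), hx]
    · rw [hM2 12 (by norm_num)]
      exact hbest.succ_of_not fun _ => hI

/-- An initial candidate is displaced only by a strictly cheaper resource. Hence, when the token's
resource is the candidate, a different result is a strict improvement and lowers the potential. -/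
theorem runs_findBest (hq : q.Specifies G) {O : Oracle} (hO : O = G.indepOracle) {B L : ℕ}
    (hB : n + m + 2 ≤ B) (hL : m ≤ L) {M : Mem} (hM : ∀ t ≤ 6, M t = q.input t) {j : Fin n}
    (hj : M 11 0 0 = j) {k : Fin m → ℕ} (hk : ∀ r : Fin m, M 8 0 r = k r) {X : Finset (Fin m)}
    (hX : ∀ r : Fin m, M 7 j r = if r ∈ X then 1 else 0) (hkn : ∀ r ∉ X, k r < n)
    (hinit : M 12 0 0 = -1 ∨ ∃ t : Fin m, M 12 0 0 = t ∧ t ∉ X ∧ G.Indep j (insert t X)) :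
    Runs O B m L .findBest M fun M' =>
      (∀ t, t ≠ 12 → t ≠ 13 → t ≠ 14 → M' t = M t) ∧
        G.IsBestBelow k j X (M 12 0 0) m (M' 12 0 0) := by
  have hm : M 0 0 1 = m := by
    rw [hM 0 (by norm_num)]
    exact table_apply (n := 1) (m := 2) (fun _ j => if j = 0 then (n : ℤ) else m) 0 1
  have hwrite : bits 0 ≤ B := (show bits 0 ≤ 2 by decide).trans (by omega)
  refine Runs.seq (Runs.write (by simpa [Exp.val] using hwrite) ?_)
  refine Runs.while_loop (k := m) (fun d M' => ∃ x : ℕ, x ≤ m ∧ d = m - x ∧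
    (∀ t, t ≠ 12 → t ≠ 13 → t ≠ 14 → M' t = M t) ∧ M' 13 0 0 = x ∧
      G.IsBestBelow k j X (M 12 0 0) x (M' 12 0 0)) ?_ ?_ ?_ hL
  · rintro d M' ⟨x, hxm, rfl, hM', h13, hbest⟩ hlt
    simp only [Exp.val, hM' 0 (by norm_num) (by norm_num) (by norm_num), hm, h13] at hlt
    have hx : x < m := by omega
    refine (runs_tryResource hq hO hB (M := M') (j := j) (k := k) (X := X) (init := M 12 0 0)
      (x := ⟨x, hx⟩) ?_ ?_ ?_ ?_ hkn h13 hbest).imp ?_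
    · intro t ht
      rw [hM' t (by omega) (by omega) (by omega), hM t ht]
    · rw [hM' 11 (by norm_num) (by norm_num) (by norm_num), hj]
    · intro r
      rw [hM' 8 (by norm_num) (by norm_num) (by norm_num), hk]
    · intro r
      rw [hM' 7 (by norm_num) (by norm_num) (by norm_num), hX]
    · rintro M'' ⟨h1, h2, h3⟩
      refine ⟨m - (x + 1), by omega, x + 1, hx, rfl, fun t t12 t13 t14 => ?_, h2, h3⟩
      rw [h1 t t12 t13 t14, hM' t t12 t13 t14]
  · rintro d M' ⟨x, hxm, rfl, hM', h13, hbest⟩ hlt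
    simp only [Exp.val, hM' 0 (by norm_num) (by norm_num) (by norm_num), hm, h13] at hlt
    obtain rfl : x = m := by omega
    exact ⟨hM', hbest⟩
  · refine ⟨0, by omega, by omega, fun t _ t13 _ => Mem.set_of_ne _ t13 _ _ _, ?_, ?_⟩
    · simp [Mem.set, Exp.val]
    · rw [Mem.set_of_ne _ (by norm_num)]
      rcases hinit with h | ⟨t, h1, h2, h3⟩
      · exact Or.inl ⟨h, h, fun c hc => absurd hc (Nat.not_lt_zero _)⟩
      · exact Or.inr ⟨t, h1, h2, h3, fun c hc => absurd hc (Nat.not_lt_zero _), Or.inl rfl⟩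

end MixedGame

namespace Ram

/-! ## The algorithm -/

/-- One step with a token on the resource in table `10`: the player in table `11` moves if it uses
that resource and can improve, and the token moves along. After a pass over all players without
such a move, the token is added to the congestion in table `8`. -/
def Prog.moveToken : Prog :=
  .ite (.sub .players (.cell 11))
    (.ite (.read 7 (.cell 11) (.cell 10))
      (.seq (.write 7 (.cell 11) (.cell 10) (.const 0))
        (.seq (.setCell 12 (.cell 10))
          (.seq .findBest
            (.seq (.write 7 (.cell 11) (.cell 12) (.const 1))
              (.ite (.mul (.sub (.cell 12) (.cell 10)) (.sub (.cell 12) (.cell 10)))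
                (.seq (.setCell 10 (.cell 12)) (.setCell 11 (.const 0)))
                (.setCell 11 (.add (.cell 11) (.const 1))))))))
      (.setCell 11 (.add (.cell 11) (.const 1))))
    (.seq (.write 8 (.const 0) (.cell 10) (.add (.read 8 (.const 0) (.cell 10)) (.const 1)))
      (.setCell 10 (.const (-1))))

/-- One step without a token: the player in table `9` adds its best resource, which gets a token.
If there is none, the next player is considered. -/
def Prog.addResource : Prog :=
  .seq (.setCell 12 (.const (-1)))
    (.seq (.setCell 11 (.cell 9))
      (.seq .findBest
        (.ite (.add (.cell 12) (.const 1))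
          (.seq (.write 7 (.cell 9) (.cell 12) (.const 1))
            (.seq (.setCell 10 (.cell 12)) (.setCell 11 (.const 0))))
          (.setCell 9 (.add (.cell 9) (.const 1))))))

/-- The computation of a pure Nash equilibrium. -/
def Prog.equilibrium : Prog :=
  .seq (.setCell 10 (.const (-1)))
    (.while (.sub .players (.cell 9)) (.ite (.add (.cell 10) (.const 1)) .moveToken .addResource))

end Ram

open Ram

/-! ### Correctness and running time of the main loop -/

namespace MixedGame

variable {n m : ℕ} {G : MixedGame (Fin n) (Fin m)} {q : RatData n m}

/-- The memory holds the input, the strategies `S`, the congestion `k` without a token, and the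
number `i` of players that have a complete strategy. -/
structure Represents (G : MixedGame (Fin n) (Fin m)) (q : RatData n m) (M : Mem)
    (S : Fin n → Finset (Fin m)) (k : Fin m → ℕ) (i : ℕ) : Prop where
  input : ∀ t ≤ 6, M t = q.input t
  state : ∀ (j : Fin n) (r : Fin m), M 7 j r = if r ∈ S j then 1 else 0
  base : ∀ r : Fin m, M 8 0 r = k r
  player : M 9 0 0 = i
  le : i ≤ n
  stable : G.IsStableAt S k
  maximal : ∀ j : Fin n, (j : ℕ) < i → ∀ X, G.Indep j X → X.card ≤ (S j).card

theorem Represents.congr {M M' : Mem} {S : Fin n → Finset (Fin m)} {k : Fin m → ℕ} {i : ℕ}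
    (h : G.Represents q M S k i) (hM : ∀ t ≤ 9, M' t = M t) : G.Represents q M' S k i where
  input t ht := (hM t (by omega)).trans (h.input t ht)
  state j r := by rw [hM 7 (by norm_num), h.state]
  base r := by rw [hM 8 (by norm_num), h.base]
  player := by rw [hM 9 (by norm_num), h.player]
  le := h.le
  stable := h.stable
  maximal := h.maximal

/-- The number of resources to be added and players to be considered. -/
def remaining (S : Fin n → Finset (Fin m)) (i : ℕ) : ℕ := (n - i) + (n * m - ∑ j, (S j).card)

/-- A bound for the number of steps between two additions of a resource. -/
def phaseLength (n m : ℕ) : ℕ := n * (m * m) * (n + 1) + n + 2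

/-- The invariant of the main loop, with a bound `μ` for the number of further iterations. -/
def LoopInv (G : MixedGame (Fin n) (Fin m)) (q : RatData n m) (μ : ℕ) (M : Mem) : Prop :=
  ∃ S k i, G.Represents q M S k i ∧
    ((M 10 0 0 = -1 ∧ congestion S = k ∧ μ = remaining S i * phaseLength n m) ∨
      ∃ (t : Fin m) (j : ℕ), M 10 0 0 = t ∧ M 11 0 0 = j ∧ j ≤ n ∧ i < n ∧
        congestion S = bump k t ∧
        (∀ j' : Fin n, (j' : ℕ) < j → t ∈ S j' → ∀ c ∉ S j',
          G.Indep j' (insert c ((S j').erase t)) →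
            G.key j' t (k t + 1) ≤ G.key j' c (k c + 1)) ∧
        μ = remaining S i * phaseLength n m + (G.potential k S * (n + 1) + (n - j) + 1))

theorem remaining_congr {S S' : Fin n → Finset (Fin m)} (h : ∀ j, (S' j).card = (S j).card)
    (i : ℕ) : remaining S' i = remaining S i := by
  simp only [remaining, h]

theorem sum_card_le (S : Fin n → Finset (Fin m)) : ∑ j, (S j).card ≤ n * m := by
  simpa using Finset.sum_le_card_nsmul Finset.univ (fun j => (S j).card) m
    fun j _ => (Finset.card_le_univ _).trans (by simp)

theorem remaining_insert {S : Fin n → Finset (Fin m)} {j : Fin n} {b : Fin m} (hb : b ∉ S j)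
    (i : ℕ) : remaining (Function.update S j (insert b (S j))) i + 1 = remaining S i := by
  have h1 := sum_card_le (Function.update S j (insert b (S j)))
  have h2 : ∑ l, (Function.update S j (insert b (S j)) l).card = ∑ l, (S l).card + 1 := by
    rw [← Finset.add_sum_erase _ _ (Finset.mem_univ j),
      ← Finset.add_sum_erase (s := Finset.univ) (a := j) (fun l => (S l).card) (Finset.mem_univ j),
      Function.update_self, Finset.card_insert_of_notMem hb]
    have : ∑ x ∈ Finset.univ.erase j, (Function.update S j (insert b (S j)) x).card =
        ∑ x ∈ Finset.univ.erase j, (S x).card :=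
      Finset.sum_congr rfl fun x hx => by rw [Function.update_of_ne (Finset.ne_of_mem_erase hx)]
    rw [this]
    ring
  simp only [remaining]
  omega

theorem state_set {M : Mem} {S : Fin n → Finset (Fin m)}
    (h : ∀ (j : Fin n) (r : Fin m), M 7 j r = if r ∈ S j then 1 else 0) (j : Fin n) (b : Fin m)
    (j' : Fin n) (r : Fin m) : (M.set 7 j b 1) 7 j' r =
      if r ∈ Function.update S j (insert b (S j)) j' then 1 else 0 := by
  by_cases hj : j' = j
  · subst hj
    by_cases hr : r = b
    · subst hr
      simp [Mem.set]
    · have : ¬ ((r : ℕ) : ℤ) = ((b : ℕ) : ℤ) := fun h => hr (Fin.ext (by exact_mod_cast h))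
      rw [Mem.set, if_neg fun h => this h.2.2, h]
      simp [hr]
  · have : ¬ ((j' : ℕ) : ℤ) = ((j : ℕ) : ℤ) := fun h => hj (Fin.ext (by exact_mod_cast h))
    rw [Mem.set, if_neg fun h => this h.2.1, h, Function.update_of_ne hj]

theorem state_unset {M : Mem} {S : Fin n → Finset (Fin m)}
    (h : ∀ (j : Fin n) (r : Fin m), M 7 j r = if r ∈ S j then 1 else 0) (j : Fin n) (b : Fin m)
    (j' : Fin n) (r : Fin m) : (M.set 7 j b 0) 7 j' r =
      if r ∈ Function.update S j ((S j).erase b) j' then 1 else 0 := by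
  by_cases hj : j' = j
  · subst hj
    by_cases hr : r = b
    · subst hr
      simp [Mem.set]
    · have : ¬ ((r : ℕ) : ℤ) = ((b : ℕ) : ℤ) := fun h => hr (Fin.ext (by exact_mod_cast h))
      rw [Mem.set, if_neg fun h => this h.2.2, h]
      simp [hr]
  · have : ¬ ((j' : ℕ) : ℤ) = ((j : ℕ) : ℤ) := fun h => hj (Fin.ext (by exact_mod_cast h))
    rw [Mem.set, if_neg fun h => this h.2.1, h, Function.update_of_ne hj]

theorem input_players {M : Mem} (hM : ∀ t ≤ 6, M t = q.input t) : M 0 0 0 = n := by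
  rw [hM 0 (by norm_num)]
  exact table_apply (n := 1) (m := 2) (fun _ j => if j = 0 then (n : ℤ) else m) 0 0

theorem bits_fin_le {B : ℕ} (hB : n + m + 2 ≤ B) (r : Fin m) : bits ((r : ℕ) : ℤ) ≤ B :=
  (bits_natCast_le _).trans (by omega)

theorem bits_succ_le {B : ℕ} (hB : n + m + 2 ≤ B) {j : ℕ} (hj : j < n) : bits ((j : ℤ) + 1) ≤ B := by
  have := bits_natCast_le (j + 1)
  push_cast at this
  omega

/-- There are three outcomes: the token moves and the pass over the players restarts, the pass
advances, or it ends and the token is absorbed. Moves preserve cardinalities, so strategies that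
were complete remain so. -/
theorem runs_moveToken (hq : q.Specifies G) (hG : ∀ i, IsIndepFamily (G.Indep i)) {O : Oracle}
    (hO : O = G.indepOracle) {B L : ℕ} (hB : n + m + 2 ≤ B) (hL : m ≤ L) {M : Mem}
    {S : Fin n → Finset (Fin m)} {k : Fin m → ℕ} {i : ℕ} (hrep : G.Represents q M S k i)
    {t : Fin m} {j : ℕ} (ht : M 10 0 0 = t) (hj : M 11 0 0 = j) (hjn : j ≤ n) (hin : i < n)
    (hcong : congestion S = bump k t)
    (hstay : ∀ j' : Fin n, (j' : ℕ) < j → t ∈ S j' → ∀ c ∉ S j',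
      G.Indep j' (insert c ((S j').erase t)) → G.key j' t (k t + 1) ≤ G.key j' c (k c + 1)) :
    Runs O B m L .moveToken M fun M' => ∃ μ' <
      remaining S i * phaseLength n m + (G.potential k S * (n + 1) + (n - j) + 1),
      G.LoopInv q μ' M' := by
  have hw0 : bits 0 ≤ B := (show bits 0 ≤ 2 by decide).trans (by omega)
  have hw1 : bits 1 ≤ B := (show bits 1 ≤ 2 by decide).trans (by omega)
  have hwn : bits (-1) ≤ B := (show bits (-1) ≤ 2 by decide).trans (by omega)
  have hn := input_players hrep.input
  refine Runs.ite (fun hlt => ?_) fun hge => ?_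
  · simp only [Exp.val, hn, hj] at hlt
    have hjn' : j < n := by omega
    obtain ⟨J, rfl⟩ : ∃ J : Fin n, (J : ℕ) = j := ⟨⟨j, hjn'⟩, rfl⟩
    have next : ∀ {M' : Mem}, G.Represents q M' S k i → M' 10 0 0 = t → M' 11 0 0 = (J : ℕ) →
        (t ∈ S J → ∀ c ∉ S J, G.Indep J (insert c ((S J).erase t)) →
          G.key J t (k t + 1) ≤ G.key J c (k c + 1)) →
        Runs O B m L (.setCell 11 (.add (.cell 11) (.const 1))) M' fun M' => ∃ μ' <
          remaining S i * phaseLength n m + (G.potential k S * (n + 1) + (n - (J : ℕ)) + 1),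
          G.LoopInv q μ' M' := by
      intro M' h1 h2 h3 h4
      refine Runs.write (by simpa [Exp.val, h3] using bits_succ_le hB hjn') ?_
      refine ⟨remaining S i * phaseLength n m + (G.potential k S * (n + 1) + (n - (J + 1)) + 1),
        by omega, S, k, i, h1.congr fun t ht => Mem.set_of_ne _ (by omega) _ _ _,
        Or.inr ⟨t, J + 1, ?_, ?_, hjn', hin, hcong, fun j' hj' => ?_, rfl⟩⟩
      · rw [Mem.set_of_ne _ (by norm_num), h2]
      · simp [Mem.set, Exp.val, h3]
      · rcases (show (j' : ℕ) < J ∨ j' = J by rw [Fin.ext_iff]; omega) with h | rfl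
        · exact hstay j' h
        · exact h4
    refine Runs.ite (fun hpos => ?_) fun hneg => ?_
    · simp only [Exp.val, hj, ht, hrep.state] at hpos
      have htS : t ∈ S J := by
        by_contra h
        simp [h] at hpos
      refine Runs.seq (Runs.write (by simpa [Exp.val] using hw0) (Runs.seq (Runs.write ?_ ?_)))
      · simpa [Exp.val, Mem.set, ht] using bits_fin_le hB t
      simp only [Exp.val, hj, ht, Mem.set_of_ne _ (show 10 ≠ 7 by norm_num)]
      have hst := state_unset hrep.state J t
      set M1 := M.set 7 (J : ℕ) t 0 with hM1
      set M2 := M1.set 12 0 0 t with hM2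
      have e2 : ∀ s, s ≠ 7 → s ≠ 12 → M2 s = M s := by
        intro s h7 h12
        rw [hM2, Mem.set_of_ne _ h12, hM1, Mem.set_of_ne _ h7]
      have e12 : M2 12 0 0 = t := by simp [hM2, Mem.set]
      -- At `t` the token occupies one of the at most `n` uses; any other `r` is not used by `J`.
      have hkn : ∀ r ∉ (S J).erase t, k r < n := by
        intro r hr
        by_cases hrt : r = t
        · subst hrt
          have := congestion_le_card S r
          rw [hcong] at this
          simpa [bump] using this
        · have := congestion_lt_card (S := S) (i := J) (r := r) (by simpa [hrt] using hr)
          rw [hcong] at this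
          simpa [bump, hrt] using this
      have htI : G.Indep J (insert t ((S J).erase t)) := by
        rw [Finset.insert_erase htS]
        exact (hrep.stable J).1
      have hfind := runs_findBest hq hO hB hL (M := M2) (j := J) (k := k) (X := (S J).erase t)
        (fun s hs => by rw [e2 s (by omega) (by omega), hrep.input s hs])
        (by rw [e2 11 (by norm_num) (by norm_num), hj])
        (fun r => by rw [e2 8 (by norm_num) (by norm_num), hrep.base])
        (fun r => by
          rw [hM2, Mem.set_of_ne _ (by norm_num), hst, Function.update_self])
        hkn (Or.inr ⟨t, e12, by simp, htI⟩)
      refine Runs.seq (hfind.imp fun M3 ⟨h3, hbest⟩ => ?_)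
      rw [e12] at hbest
      obtain ⟨b, hb, hbX, hbI, hmin, himp⟩ : ∃ b : Fin m, M3 12 0 0 = b ∧ b ∉ (S J).erase t ∧
          G.Indep J (insert b ((S J).erase t)) ∧
          (∀ c ∉ (S J).erase t, G.Indep J (insert c ((S J).erase t)) →
            G.key J b (k b + 1) ≤ G.key J c (k c + 1)) ∧
          (b = t ∨ G.key J b (k b + 1) < G.key J t (k t + 1)) := by
        rcases hbest with ⟨-, h, -⟩ | ⟨b, h1, h2, h4, h5, h6⟩
        · omega
        · refine ⟨b, h1, h2, h4, fun c => h5 c c.2, ?_⟩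
          rcases h6 with h6 | h6
          · exact Or.inl (Fin.ext (by omega))
          · exact Or.inr (h6 t rfl)
      have f3 : ∀ s, s ≠ 7 → s ≠ 12 → s ≠ 13 → s ≠ 14 → M3 s = M s := by
        intro s h7 h12 h13 h14
        rw [h3 s h12 h13 h14, e2 s h7 h12]
      refine Runs.seq (Runs.write (by simpa [Exp.val] using hw1) ?_)
      have e311 : M3 11 0 0 = (J : ℕ) := by
        rw [f3 11 (by norm_num) (by norm_num) (by norm_num) (by norm_num), hj]
      simp only [Exp.val, e311, hb]
      have hst3 : ∀ (j' : Fin n) (r : Fin m), (M3.set 7 (J : ℕ) b 1) 7 j' r =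
          if r ∈ Function.update S J (insert b ((S J).erase t)) j' then 1 else 0 := by
        intro j' r
        have := state_set (M := M3) (S := Function.update S J ((S J).erase t)) (fun j' r => by
          rw [h3 7 (by norm_num) (by norm_num) (by norm_num), hM2, Mem.set_of_ne _ (by norm_num),
            hst]) J b j' r
        simpa using this
      set M4 := M3.set 7 (J : ℕ) b 1 with hM4
      have f4 : ∀ s, s ≠ 7 → s ≠ 12 → s ≠ 13 → s ≠ 14 → M4 s = M s := by
        intro s h7 h12 h13 h14
        rw [hM4, Mem.set_of_ne _ h7, f3 s h7 h12 h13 h14]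
      have e410 : M4 10 0 0 = t := by
        rw [f4 10 (by norm_num) (by norm_num) (by norm_num) (by norm_num), ht]
      have e411 : M4 11 0 0 = (J : ℕ) := by
        rw [f4 11 (by norm_num) (by norm_num) (by norm_num) (by norm_num), hj]
      have e412 : M4 12 0 0 = b := by rw [hM4, Mem.set_of_ne _ (by norm_num), hb]
      refine Runs.ite (fun hne => ?_) fun heq => ?_
      · have hbt : b ≠ t := by
          rintro rfl
          simp [Exp.val, e410, e412] at hne
        have hbS : b ∉ S J := fun h => hbX (Finset.mem_erase.2 ⟨hbt, h⟩)
        have hlt' : G.key J b (k b + 1) < G.key J t (k t + 1) := himp.resolve_left hbt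
        have hcard := card_move (S := S) (i := J) htS hbS
        have hpot := G.potential_move (k := k) htS hbS hlt'
        refine Runs.seq (Runs.write (by simpa [Exp.val, e412] using bits_fin_le hB b)
          (Runs.write (by simpa [Exp.val] using hw0) ?_))
        simp only [Exp.val, e412]
        set S' := Function.update S J (insert b ((S J).erase t)) with hS'
        refine ⟨remaining S' i * phaseLength n m + (G.potential k S' * (n + 1) + (n - 0) + 1), ?_,
          S', k, i, ?_, Or.inr ⟨b, 0, ?_, ?_, Nat.zero_le _, hin, congestion_move hcong htS hbS,
            fun j' hj' => absurd hj' (Nat.not_lt_zero _), rfl⟩⟩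
        -- A drop of the potential frees `n + 1` units, which pays for restarting the pass at player
        -- `0`.
        · rw [remaining_congr hcard]
          have := Nat.mul_le_mul_right (n + 1) (Nat.succ_le_of_lt hpot)
          rw [Nat.succ_mul] at this
          omega
        · refine Represents.congr (M := M4) ?_ fun s hs => ?_
          · exact
              { input := fun s hs => by
                  rw [f4 s (by omega) (by omega) (by omega) (by omega), hrep.input s hs]
                state := hst3
                base := fun r => by
                  rw [f4 8 (by norm_num) (by norm_num) (by norm_num) (by norm_num), hrep.base]
                player := by
                  rw [f4 9 (by norm_num) (by norm_num) (by norm_num) (by norm_num), hrep.player]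
                le := hrep.le
                stable := hrep.stable.move hG htS hbS hbI hlt' fun c hc =>
                  hmin c fun h => hc (Finset.mem_of_mem_erase h)
                maximal := fun j' hj' X hX => by
                  rw [hcard]
                  exact hrep.maximal j' hj' X hX }
          · rw [Mem.set_of_ne _ (by omega), Mem.set_of_ne _ (by omega)]
        · rw [Mem.set_of_ne _ (by norm_num)]
          simp [Mem.set]
        · simp [Mem.set]
      · have hbt : b = t := by
          simp only [Exp.val, e410, e412, not_lt] at heq
          -- The program tests `b ≠ t` by the sign of a square.
          have : ((b : ℕ) : ℤ) - ((t : ℕ) : ℤ) = 0 := by nlinarith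
          exact Fin.ext (by omega)
        subst hbt
        rw [Finset.insert_erase htS, Function.update_eq_self] at hst3
        refine next ?_ e410 e411 fun _ c hc => hmin c fun h => hc (Finset.mem_of_mem_erase h)
        exact
          { input := fun s hs => by
              rw [f4 s (by omega) (by omega) (by omega) (by omega), hrep.input s hs]
            state := hst3
            base := fun r => by
              rw [f4 8 (by norm_num) (by norm_num) (by norm_num) (by norm_num), hrep.base]
            player := by
              rw [f4 9 (by norm_num) (by norm_num) (by norm_num) (by norm_num), hrep.player]
            le := hrep.le
            stable := hrep.stable
            maximal := hrep.maximal }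
    · refine next hrep ht hj fun h => ?_
      simp [Exp.val, hj, ht, hrep.state, h] at hneg
  · simp only [Exp.val, hn, hj] at hge
    have hkt : k t < n := by
      have := congestion_le_card S t
      rw [hcong] at this
      simpa [bump] using this
    refine Runs.seq (Runs.write ?_ (Runs.write (by simpa [Exp.val] using hwn) ?_))
    · simpa [Exp.val, ht, hrep.base] using bits_succ_le hB hkt
    simp only [Exp.val, ht, hrep.base]
    refine ⟨remaining S i * phaseLength n m, by omega, S, bump k t, i, ?_, Or.inl ⟨?_, hcong, rfl⟩⟩
    · refine Represents.congr (M := M.set 8 0 t (k t + 1)) ?_ fun s hs =>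
        Mem.set_of_ne _ (by omega) _ _ _
      exact
        { input := fun s hs => by rw [Mem.set_of_ne _ (by omega), hrep.input s hs]
          state := fun j' r => by rw [Mem.set_of_ne _ (by norm_num), hrep.state]
          base := fun r => by
            by_cases hr : r = t
            · subst hr
              simp [Mem.set, bump]
            · have : ¬ ((r : ℕ) : ℤ) = ((t : ℕ) : ℤ) := fun h => hr (Fin.ext (by exact_mod_cast h))
              rw [Mem.set, if_neg fun h => this h.2.2, hrep.base]
              simp [bump, hr]
          player := by rw [Mem.set_of_ne _ (by norm_num), hrep.player]
          le := hrep.le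
          stable := hrep.stable.settle fun j' => hstay j' (by omega)
          maximal := hrep.maximal }
    · simp [Mem.set]

/-- Either a resource is added or the current player is complete; `remaining` drops by one in both
cases. When nothing can be added, augmentation gives maximal cardinality. -/
theorem runs_addResource (hq : q.Specifies G) (hG : ∀ i, IsIndepFamily (G.Indep i)) {O : Oracle}
    (hO : O = G.indepOracle) {B L : ℕ} (hB : n + m + 2 ≤ B) (hL : m ≤ L) {M : Mem}
    {S : Fin n → Finset (Fin m)} {k : Fin m → ℕ} {i : ℕ} (hrep : G.Represents q M S k i)
    (ht : M 10 0 0 = -1) (hin : i < n) (hcong : congestion S = k) :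
    Runs O B m L .addResource M fun M' => ∃ μ' < remaining S i * phaseLength n m,
      G.LoopInv q μ' M' := by
  have hw0 : bits 0 ≤ B := (show bits 0 ≤ 2 by decide).trans (by omega)
  have hw1 : bits 1 ≤ B := (show bits 1 ≤ 2 by decide).trans (by omega)
  have hwn : bits (-1) ≤ B := (show bits (-1) ≤ 2 by decide).trans (by omega)
  obtain ⟨J, rfl⟩ : ∃ J : Fin n, (J : ℕ) = i := ⟨⟨i, hin⟩, rfl⟩
  have hi := hrep.player
  refine Runs.seq (Runs.write (by simpa [Exp.val] using hwn) (Runs.seq (Runs.write ?_ ?_)))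
  · simpa [Exp.val, Mem.set, hi] using (bits_natCast_le (J : ℕ)).trans (by omega)
  simp only [Exp.val, hi, Mem.set_of_ne _ (show 9 ≠ 12 by norm_num)]
  set M2 := (M.set 12 0 0 (-1)).set 11 0 0 (J : ℕ) with hM2
  have e2 : ∀ s, s ≠ 11 → s ≠ 12 → M2 s = M s := by
    intro s h11 h12
    rw [hM2, Mem.set_of_ne _ h11, Mem.set_of_ne _ h12]
  have e12 : M2 12 0 0 = -1 := by simp [hM2, Mem.set]
  have hfind := runs_findBest hq hO hB hL (M := M2) (j := J) (k := k) (X := S J)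
    (fun s hs => by rw [e2 s (by omega) (by omega), hrep.input s hs])
    (by simp [hM2, Mem.set])
    (fun r => by rw [e2 8 (by norm_num) (by norm_num), hrep.base])
    (fun r => by rw [e2 7 (by norm_num) (by norm_num), hrep.state])
    (fun r hr => by simpa [hcong] using congestion_lt_card (S := S) hr) (Or.inl e12)
  refine Runs.seq (hfind.imp fun M3 ⟨h3, hbest⟩ => ?_)
  rw [e12] at hbest
  have f3 : ∀ s, s ≠ 11 → s ≠ 12 → s ≠ 13 → s ≠ 14 → M3 s = M s := by
    intro s h11 h12 h13 h14
    rw [h3 s h12 h13 h14, e2 s h11 h12]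
  have hrep3 : G.Represents q M3 S k J :=
    hrep.congr fun s hs => f3 s (by omega) (by omega) (by omega) (by omega)
  rcases hbest with ⟨hd, -, hnone⟩ | ⟨b, hb, hbS, hbI, hmin, -⟩
  · refine Runs.ite (fun h => ?_) fun _ => Runs.write ?_ ?_
    · simp [Exp.val, hd] at h
    · simpa [Exp.val, hrep3.player] using bits_succ_le hB hin
    · simp only [Exp.val, hrep3.player]
      have hrem : remaining S (J + 1) + 1 = remaining S J := by
        simp only [remaining]
        omega
      refine ⟨remaining S (J + 1) * phaseLength n m, ?_, S, k, J + 1, ?_, Or.inl ⟨?_, hcong, rfl⟩⟩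
      · rw [← hrem]
        refine Nat.mul_lt_mul_of_pos_right (Nat.lt_succ_self _) ?_
        simp only [phaseLength]
        omega
      · exact
          { input := fun s hs => by rw [Mem.set_of_ne _ (by omega), hrep3.input s hs]
            state := fun j' r => by rw [Mem.set_of_ne _ (by norm_num), hrep3.state]
            base := fun r => by rw [Mem.set_of_ne _ (by norm_num), hrep3.base]
            player := by simp [Mem.set]
            le := hin
            stable := hrep.stable
            maximal := fun j' hj' => by
              rcases (show (j' : ℕ) < J ∨ j' = J by rw [Fin.ext_iff]; omega) with h | rfl
              · exact hrep.maximal j' h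
              · exact (hG j').card_le_of_maximal (hrep.stable j').1 fun c => hnone c c.2 }
      · rw [Mem.set_of_ne _ (by norm_num), f3 10 (by norm_num) (by norm_num) (by norm_num)
          (by norm_num), ht]
  · refine Runs.ite (fun _ => ?_) fun h => ?_
    · refine Runs.seq (Runs.write (by simpa [Exp.val] using hw1) ?_)
      simp only [Exp.val, hrep3.player, hb]
      have hst := state_set hrep3.state J b
      set M4 := M3.set 7 (J : ℕ) b 1 with hM4
      have f4 : ∀ s, s ≠ 7 → M4 s = M3 s := fun s h7 => by rw [hM4, Mem.set_of_ne _ h7]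
      have e412 : M4 12 0 0 = b := by rw [f4 12 (by norm_num), hb]
      refine Runs.seq (Runs.write (by simpa [Exp.val, e412] using bits_fin_le hB b)
        (Runs.write (by simpa [Exp.val] using hw0) ?_))
      simp only [Exp.val, e412]
      have hrem := remaining_insert hbS J
      set S' := Function.update S J (insert b (S J)) with hS'
      refine ⟨remaining S' J * phaseLength n m + (G.potential k S' * (n + 1) + (n - 0) + 1), ?_,
        S', k, J, ?_, Or.inr ⟨b, 0, ?_, ?_, Nat.zero_le _, hin, congestion_insert hcong hbS,
          fun j' hj' => absurd hj' (Nat.not_lt_zero _), rfl⟩⟩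
      -- A new token brings a measure of at most `n * (m * m) * (n + 1) + n + 1`; the one extra unit
      -- in `phaseLength` makes the decrease strict.
      · have hpot := G.potential_le k S'
        simp only [Fintype.card_fin] at hpot
        have := Nat.mul_le_mul_right (n + 1) hpot
        rw [← hrem, add_mul, one_mul]
        simp only [phaseLength]
        omega
      · refine Represents.congr (M := M4) ?_ fun s hs => ?_
        · exact
            { input := fun s hs => by rw [f4 s (by omega), hrep3.input s hs]
              state := hst
              base := fun r => by rw [f4 8 (by norm_num), hrep3.base]
              player := by rw [f4 9 (by norm_num), hrep3.player]
              le := hrep.le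
              stable := hrep.stable.add_resource hG hbS hbI fun c => hmin c c.2
              maximal := fun j' hj' X hX => by
                have hne : j' ≠ J := fun h => by simp [h] at hj'
                rw [hS', Function.update_of_ne hne]
                exact hrep.maximal j' hj' X hX }
        · rw [Mem.set_of_ne _ (by omega), Mem.set_of_ne _ (by omega)]
      · rw [Mem.set_of_ne _ (by norm_num)]
        simp [Mem.set]
      · simp [Mem.set]
    · simp only [Exp.val, hb] at h
      omega

theorem runs_equilibrium (hG : G.IsTractable) (hq : q.Specifies G) {B L : ℕ}
    (hB : n + m + 2 ≤ B) (hm : m ≤ L) (hL : (n + n * m) * phaseLength n m ≤ L) :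
    Runs G.indepOracle B m L .equilibrium q.input fun M =>
      ∃ S : Fin n → Finset (Fin m), Outputs M S ∧ G.IsPNE S := by
  have hwn : bits (-1) ≤ B := (show bits (-1) ≤ 2 by decide).trans (by omega)
  refine Runs.seq (Runs.write (by simpa [Exp.val] using hwn) ?_)
  refine Runs.while_loop (k := (n + n * m) * phaseLength n m) (G.LoopInv q) ?_ ?_ ?_ hL
  · rintro μ M ⟨S, k, i, hrep, hcase⟩ hlt
    simp only [Exp.val, input_players hrep.input, hrep.player] at hlt
    rcases hcase with ⟨ht, hcong, rfl⟩ | ⟨t, j, ht, hj, hjn, hin, hcong, hstay, rfl⟩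
    · refine Runs.ite (fun h => ?_) fun _ =>
        runs_addResource hq hG.isIndepFamily rfl hB hm hrep ht (by omega) hcong
      simp [Exp.val, ht] at h
    · refine Runs.ite (fun _ => runs_moveToken hq hG.isIndepFamily rfl hB hm hrep ht hj hjn hin
        hcong hstay) fun h => ?_
      simp only [Exp.val, ht] at h
      omega
  · rintro μ M ⟨S, k, i, hrep, hcase⟩ hge
    simp only [Exp.val, input_players hrep.input, hrep.player] at hge
    rcases hcase with ⟨ht, hcong, rfl⟩ | ⟨t, j, ht, hj, hjn, hin, hcong, hstay, rfl⟩
    · refine ⟨S, hrep.state, hG.isPNE (hcong ▸ hrep.stable) fun j => hrep.maximal j ?_⟩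
      have := j.2
      omega
    · omega
  · refine ⟨fun _ => ∅, fun _ => 0, 0, ?_, Or.inl ⟨?_, ?_, ?_⟩⟩
    · refine Represents.congr (M := q.input) ?_ fun s hs => Mem.set_of_ne _ (by omega) _ _ _
      exact
        { input := fun _ _ => rfl
          state := fun _ _ => by simp [RatData.input]
          base := fun _ => rfl
          player := rfl
          le := Nat.zero_le _
          stable := G.isStableAt_empty _
          maximal := fun j hj => absurd hj (Nat.not_lt_zero _) }
    · simp [Mem.set, Exp.val]
    · funext r
      simp [congestion]
    -- The empty state has `n` players to consider and `n * m` resources to add at most.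
    · simp [remaining]

end MixedGame

/-! ### Bit length of the input -/

namespace RatData

variable {n m : ℕ}

theorem bounded_table {a b B : ℕ} {f : Fin a → Fin b → ℤ} (hB : 1 ≤ B)
    (h : ∀ i j, bits (f i j) ≤ B) (x y : ℤ) : bits (table f x y) ≤ B := by
  unfold table
  split_ifs
  · exact h _ _
  · exact le_trans (by decide) hB

theorem add_le_size (q : RatData n m) : n + m ≤ q.size := by
  unfold size
  omega

theorem ratBits_pref_le (q : RatData n m) (i : Fin n) : ratBits (q.pref i) ≤ q.size := by
  have := Finset.single_le_sum (f := fun i => ratBits (q.pref i)) (fun _ _ => Nat.zero_le _)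
    (Finset.mem_univ i)
  unfold size
  omega

theorem ratBits_cost_le (q : RatData n m) (r : Fin m) (k : Fin n) :
    ratBits (q.lat r k) + ratBits (q.bot r k) ≤ q.size := by
  have h1 := Finset.single_le_sum (f := fun k => ratBits (q.lat r k) + ratBits (q.bot r k))
    (fun _ _ => Nat.zero_le _) (Finset.mem_univ k)
  have h2 := Finset.single_le_sum
    (f := fun r => ∑ k, (ratBits (q.lat r k) + ratBits (q.bot r k)))
    (fun _ _ => Nat.zero_le _) (Finset.mem_univ r)
  unfold size
  omega

theorem bounded_input (q : RatData n m) : Bounded (q.size + 2) q.input := by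
  have hp := q.ratBits_pref_le
  have hc := q.ratBits_cost_le
  have hs := q.add_le_size
  simp only [ratBits] at hp hc
  have hB : 1 ≤ q.size + 2 := by omega
  intro t a b
  match t with
  | 0 =>
    refine bounded_table (f := fun (_ : Fin 1) (j : Fin 2) => if j = 0 then (n : ℤ) else m) hB
      (fun i j => ?_) a b
    split_ifs
    · exact (bits_natCast_le n).trans (by omega)
    · exact (bits_natCast_le m).trans (by omega)
  | 1 =>
    exact bounded_table (f := fun (i : Fin n) (_ : Fin 1) => (q.pref i).num) hB
      (fun i _ => by have := hp i; omega) a b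
  | 2 =>
    exact bounded_table (f := fun (i : Fin n) (_ : Fin 1) => ((q.pref i).den : ℤ)) hB
      (fun i _ => by have := hp i; omega) a b
  | 3 =>
    exact bounded_table (f := fun r k => (q.lat r k).num) hB
      (fun r k => by have := hc r k; omega) a b
  | 4 =>
    exact bounded_table (f := fun r k => ((q.lat r k).den : ℤ)) hB
      (fun r k => by have := hc r k; omega) a b
  | 5 =>
    exact bounded_table (f := fun r k => (q.bot r k).num) hB
      (fun r k => by have := hc r k; omega) a b
  | 6 =>
    exact bounded_table (f := fun r k => ((q.bot r k).den : ℤ)) hB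
      (fun r k => by have := hc r k; omega) a b
  | _ + 7 => exact (show bits 0 ≤ 1 by decide).trans hB

end RatData

/-! ### Existence and polynomial running time -/

theorem theorem1 :
    (∀ (N : Type*) (R : Type*) [Fintype N] [DecidableEq N] [Fintype R] [DecidableEq R]
      (G : MixedGame N R),
      (G.IsSingletonGame ∨ (G.IsMatroidGame ∧ G.HasPurePreferences) ∨
        (G.IsMatroidGame ∧ G.HasMonotoneDependence)) →
      ∃ S : N → Finset R, G.IsPNE S) ∧
    (∃ (P : Ram.Prog) (p : Polynomial ℕ), ∀ (n m : ℕ) (G : MixedGame (Fin n) (Fin m))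
      (q : RatData n m), q.Specifies G →
      (G.IsSingletonGame ∨ (G.IsMatroidGame ∧ G.HasPurePreferences) ∨
        (G.IsMatroidGame ∧ G.HasMonotoneDependence)) →
      ∃ (time : ℕ) (M : Ram.Mem) (S : Fin n → Finset (Fin m)),
        Ram.Exec G.indepOracle P q.input time M ∧ time ≤ p.eval q.size ∧
        MixedGame.Outputs M S ∧ G.IsPNE S) := by
  refine ⟨fun N R _ _ _ _ G h => MixedGame.IsTractable.exists_isPNE h, ?_⟩
  -- This is `(n + n * m) * phaseLength n m` with `n` and `m` replaced by the input size. It bounds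
  -- the rounds of every loop and is therefore substituted into the weight of the program; the other
  -- factor is cell length times query length plus one.
  let loops : Polynomial ℕ := (Polynomial.X + Polynomial.X * Polynomial.X) *
    (Polynomial.X * (Polynomial.X * Polynomial.X) * (Polynomial.X + 1) + Polynomial.X + 2)
  refine ⟨Prog.equilibrium, Prog.equilibrium.weight.comp loops *
    ((Polynomial.X + 2) * (Polynomial.X + 1)), fun n m G q hq h => ?_⟩
  have hs := q.add_le_size
  have hn : n ≤ q.size := by omega
  have hm : m ≤ q.size := by omega
  have hloops : loops.eval q.size = (q.size + q.size * q.size) *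
      (q.size * (q.size * q.size) * (q.size + 1) + q.size + 2) := by
    simp [loops]
  have hL : (n + n * m) * MixedGame.phaseLength n m ≤ loops.eval q.size := by
    rw [hloops, MixedGame.phaseLength]
    gcongr
  have hmL : m ≤ loops.eval q.size := by
    rw [hloops]
    exact hm.trans ((Nat.le_add_right _ _).trans (Nat.le_mul_of_pos_right _ (by omega)))
  obtain ⟨c, M, h1, h2, -, S, h3, h4⟩ := MixedGame.runs_equilibrium (G := G) h hq
    (B := q.size + 2) (by omega) hmL hL (by omega) q.bounded_input
  refine ⟨c, M, S, h1, h2.trans ?_, h3, h4⟩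
  have hp : (Prog.equilibrium.weight.comp loops *
      ((Polynomial.X + 2) * (Polynomial.X + 1))).eval q.size =
      Prog.equilibrium.weight.eval (loops.eval q.size) * ((q.size + 2) * (q.size + 1)) := by
    rw [Polynomial.eval_mul, Polynomial.eval_comp]
    simp
  rw [hp]
  gcongr
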